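/- For $n\ge 1$ let $S^{2n-1}$ be the unit sphere of $\mathbb C^n$. A rational CR map $f\colon S^{2n-1}\to S^{2N-1}$ is a map $f=p/q$, where $p=(p_1,\dots,p_N)$ and $q$ are holomorphic polynomials without common factor and $q\neq 0$ on $S^{2n-1}$; its degree is $\max(\deg p_1,\dots,\deg p_N,\deg q)$. Maps $f\colon S^{2n-1}\to S^{2N-1}$ and $g\colon S^{2n-1}\to S^{2M-1}$ are spherically equivalent if, after adding zero components to the one with the smaller target dimension so that both have target $S^{2K-1}$, $K=\max(N,M)$, one has $f\circ\chi=\tau\circ g$ on $S^{2n-1}$ for linear fractional automorphisms $\chi$ of $S^{2n-1}$ and $\tau$ of $S^{2K-1}$ (bijections of the sphere that are induced by automorphisms of the ambient projective space). Proposition. For every $n\ge 2$ there are $N$ and a rational CR map $f\colon S^{2n-1}\to S^{2N-1}$ of degree three that is not spherically equivalent to any polynomial map $g\colon S^{2n-1}\to S^{2M-1}$ ($M$ arbitrary) that takes the origin to the origin. Moreover, for $n=2$ there is a real two-dimensional family of such maps: there are $N$, a nonempty open set $U\subset\mathbb R^2$ and rational CR maps $F_t=p_t/q_t\colon S^3\to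 S^{2N-1}$ ($t\in U$) of degree three (in lowest terms), such that the coefficients of $p_t$ and $q_t$ are $C^\infty$ functions of $t\in U$, no $F_t$ is spherically equivalent to a polynomial map of spheres (with any target dimension) that takes the origin to the origin, and $F_s$ and $F_t$ are not spherically equivalent when $s\neq t$. -/

import Mathlib

open scoped ContDiff

namespace SphereMaps

/-- The unit sphere `S^{2n-1}` in `ℂⁿ` (with the Euclidean norm). -/
abbrev USphere (n : ℕ) : Type :=
  Metric.sphere (0 : EuclideanSpace ℂ (Fin n)) 1

/-- The value of a holomorphic polynomial at a point of the sphere. -/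
noncomputable def evalAt {n : ℕ} (q : MvPolynomial (Fin n) ℂ) (z : USphere n) : ℂ :=
  MvPolynomial.eval (fun i => (z : EuclideanSpace ℂ (Fin n)) i) q

/-- The numerators `p` and the denominator `q` have no common factor. -/
def LowestTerms {n N : ℕ} (p : Fin N → MvPolynomial (Fin n) ℂ)
    (q : MvPolynomial (Fin n) ℂ) : Prop :=
  ∀ h : MvPolynomial (Fin n) ℂ, (∀ i, h ∣ p i) → h ∣ q → IsUnit h

/-- The largest of the degrees of the numerators and of the denominator. -/
noncomputable def fractionDegree {n N : ℕ} (p : Fin N → MvPolynomial (Fin n) ℂ)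
    (q : MvPolynomial (Fin n) ℂ) : ℕ :=
  max (Finset.univ.sup fun i => (p i).totalDegree) q.totalDegree

/-- `f = p / q` on the sphere, in lowest terms, with maximal degree `d`, where `q` has no zero on
the sphere. As the restriction of a map that is holomorphic near the sphere, such
an `f : S^{2n-1} → S^{2N-1}` is automatically a (real-analytic) CR map. -/
structure RepresentsCRMap {n N : ℕ} (d : ℕ) (p : Fin N → MvPolynomial (Fin n) ℂ)
    (q : MvPolynomial (Fin n) ℂ) (f : USphere n → USphere N) : Prop where
  lowestTerms : LowestTerms p q
  degree_eq : fractionDegree p q = d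
  denom_ne_zero : ∀ z, evalAt q z ≠ 0
  value_eq : ∀ z i, (f z : EuclideanSpace ℂ (Fin N)) i = evalAt (p i) z / evalAt q z

/-- `f : S^{2n-1} → S^{2N-1}` is a rational CR map of degree `d`. -/
def IsRationalCRMap {n N : ℕ} (d : ℕ) (f : USphere n → USphere N) : Prop :=
  ∃ (p : Fin N → MvPolynomial (Fin n) ℂ) (q : MvPolynomial (Fin n) ℂ), RepresentsCRMap d p q f

/-- `g : S^{2n-1} → S^{2N-1}` is the restriction of a (holomorphic) polynomial map
`ℂⁿ → ℂᴺ` that takes the origin to the origin. -/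
def IsPolynomialFixingOrigin {n N : ℕ} (g : USphere n → USphere N) : Prop :=
  ∃ P : Fin N → MvPolynomial (Fin n) ℂ,
    (∀ z i, (g z : EuclideanSpace ℂ (Fin N)) i = evalAt (P i) z) ∧
    ∀ i, MvPolynomial.eval (0 : Fin n → ℂ) (P i) = 0

/-- Homogeneous coordinates `(1, z₁, …, zₙ)` of a point of the sphere. -/
def homog {n : ℕ} (z : USphere n) : Fin (n + 1) → ℂ :=
  Fin.cons 1 fun i => (z : EuclideanSpace ℂ (Fin n)) i

/-- A bijection of the sphere is a (linear fractional) sphere automorphism if it is induced by an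
automorphism of projective space, that is, by an invertible matrix acting on homogeneous
coordinates. -/
def IsSphereAut {n : ℕ} (φ : USphere n ≃ USphere n) : Prop :=
  ∃ M : Matrix (Fin (n + 1)) (Fin (n + 1)) ℂ, IsUnit M.det ∧
    ∀ z, ∃ c : ℂ, c ≠ 0 ∧ M.mulVec (homog z) = c • homog (φ z)

/-- The vector `v ⊕ 0` in `ℂᴷ`, for `v` in `ℂᴺ` and `N ≤ K`. -/
noncomputable def padVec {N : ℕ} (K : ℕ) (v : EuclideanSpace ℂ (Fin N)) :
    EuclideanSpace ℂ (Fin K) :=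
  WithLp.toLp 2 fun i => if h : (i : ℕ) < N then v ⟨i, h⟩ else 0

theorem norm_padVec {N K : ℕ} (h : N ≤ K) (v : EuclideanSpace ℂ (Fin N)) :
    ‖padVec K v‖ = ‖v‖ := by
  obtain ⟨k, rfl⟩ := Nat.exists_eq_add_of_le h
  rw [EuclideanSpace.norm_eq, EuclideanSpace.norm_eq, Fin.sum_univ_add]
  simp [padVec]

/-- The map `f ⊕ 0 : S^{2n-1} → S^{2K-1}`, for `f : S^{2n-1} → S^{2N-1}` and `N ≤ K`. -/
noncomputable def padMap {n N K : ℕ} (h : N ≤ K) (f : USphere n → USphere N) :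
    USphere n → USphere K :=
  fun z => ⟨padVec K (f z : EuclideanSpace ℂ (Fin N)), by
    rw [mem_sphere_zero_iff_norm, norm_padVec h]
    exact mem_sphere_zero_iff_norm.mp (f z).2⟩

/-- Spherical equivalence: `f ∘ χ = τ ∘ g` with sphere automorphisms `χ` of the source and `τ` of
the target; if the target dimensions differ, zero components are first added to the map with the
smaller one. -/
def SphericallyEquivalent {n N M : ℕ} (f : USphere n → USphere N) (g : USphere n → USphere M) :
    Prop :=
  ∃ (χ : USphere n ≃ USphere n) (τ : USphere (max N M) ≃ USphere (max N M)),
    IsSphereAut χ ∧ IsSphereAut τ ∧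
    padMap (le_max_left N M) f ∘ χ = τ ∘ padMap (le_max_right N M) g

/-- `f` is not spherically equivalent to any polynomial map of spheres (in any target
dimension) that takes the origin to the origin. -/
def NotEquivToPolynomialFixingOrigin {n N : ℕ} (f : USphere n → USphere N) : Prop :=
  ∀ (M : ℕ) (g : USphere n → USphere M),
    IsPolynomialFixingOrigin g → ¬ SphericallyEquivalent f g

end SphereMaps

namespace SphereMaps

open MvPolynomial
open scoped ComplexConjugate

/-! ### The Hermitian form of signature `(1, k)` -/

/-! In homogeneous coordinates a map becomes a tuple `Φ` of forms of degree d, and `lorentz` of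
`Φ(x)` and `Φ(y)` is the polarization of |q|² − |p|². Sphere automorphisms are matrices that scale
`lorentz`. If f∘χ = τ∘g has lifts `Φ`, `Ψ` and matrices `M`, `T`, then Ψ₀·(Φ∘M) = ν·TΨ for a form ν
of degree d, and ν divides Ψ₀ as soon as two entries of `Φ` are coprime (`exists_factor`).

If g is polynomial with g(0) = 0, then Ψ₀ = X₀^e, so ν is a multiple of X₀^d. Hence the polarized
form of f, with second argument fixed at w = χ(0), is a multiple of (1 − ⟨z,w⟩)^d. If instead both
lifts have degree d, then Ψ₀ is a constant multiple of ν and `M` carries one polarized form to a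
multiple of the other.

The family is built so that its polarized form is (1 − ⟨z,w⟩)(1 + s z₀z₁ + s conj(w₀w₁) + β(⟨z,w⟩ +
⟨z,w⟩²)) with s = `quadCoeff t` and β = `cubeCoeff t`² (`den_mul_sub_num`). Were this C(1 − ⟨z,w⟩)³
for a fixed w, the quadratic terms in z would make z₀z₁ a multiple of the square of a linear form
(`not_forall_eq_cube`). An equivalence between two members must fix the origin of the source
(`center_eq_zero`), so it acts unitarily. Then the maximum of |s z₀z₁| on a sphere gives s, one
further value gives β, and (s, β) determines t (`eq_of_coeff_eq`). -/

/-- The standard Hermitian form of signature `(1, k)` on `ℂ^{k+1}`. -/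
noncomputable def lorentz {k : ℕ} (x y : Fin (k + 1) → ℂ) : ℂ :=
  x 0 * conj (y 0) - ∑ i : Fin k, x i.succ * conj (y i.succ)

theorem lorentz_add_left {k : ℕ} (x x' y : Fin (k + 1) → ℂ) :
    lorentz (x + x') y = lorentz x y + lorentz x' y := by
  simp only [lorentz, Pi.add_apply, add_mul, Finset.sum_add_distrib]; ring

theorem lorentz_add_right {k : ℕ} (x y y' : Fin (k + 1) → ℂ) :
    lorentz x (y + y') = lorentz x y + lorentz x y' := by
  simp only [lorentz, Pi.add_apply, map_add, mul_add, Finset.sum_add_distrib]; ring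

theorem lorentz_smul_left {k : ℕ} (c : ℂ) (x y : Fin (k + 1) → ℂ) :
    lorentz (c • x) y = c * lorentz x y := by
  simp only [lorentz, Pi.smul_apply, smul_eq_mul, mul_sub, Finset.mul_sum, mul_assoc]

theorem lorentz_smul_right {k : ℕ} (c : ℂ) (x y : Fin (k + 1) → ℂ) :
    lorentz x (c • y) = conj c * lorentz x y := by
  simp only [lorentz, Pi.smul_apply, smul_eq_mul, mul_sub, Finset.mul_sum, map_mul]
  congr 1
  · ring
  · exact Finset.sum_congr rfl fun i _ => by ring

/-- The first standard basis vector, the homogeneous coordinates of the origin. -/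
def origin (k : ℕ) : Fin (k + 1) → ℂ := Fin.cons 1 0

@[simp] theorem origin_zero (k : ℕ) : origin k 0 = 1 := rfl

@[simp] theorem origin_succ (k : ℕ) (i : Fin k) : origin k i.succ = 0 := rfl

theorem lorentz_origin_right {k : ℕ} (x : Fin (k + 1) → ℂ) : lorentz x (origin k) = x 0 := by
  simp [lorentz]

theorem lorentz_self {k : ℕ} (x : Fin (k + 1) → ℂ) :
    lorentz x x = ((‖x 0‖ ^ 2 - ∑ i : Fin k, ‖x i.succ‖ ^ 2 : ℝ) : ℂ) := by
  simp [lorentz, Complex.mul_conj']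

theorem exists_sphere_smul {k : ℕ} {x : Fin (k + 1) → ℂ} (hx : lorentz x x = 0) (h0 : x 0 ≠ 0) :
    ∃ z : USphere k, x = x 0 • homog z := by
  refine ⟨⟨WithLp.toLp 2 fun i => x i.succ / x 0, ?_⟩, ?_⟩
  · rw [mem_sphere_zero_iff_norm, EuclideanSpace.norm_eq]
    rw [lorentz_self, Complex.ofReal_eq_zero, sub_eq_zero] at hx
    have h1 : (‖x 0‖ ^ 2) ≠ 0 := by simpa using h0
    simp only [norm_div, div_pow, ← Finset.sum_div, ← hx, div_self h1, Real.sqrt_one]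
  · funext i
    refine Fin.cases ?_ (fun j => ?_) i
    · simp [homog]
    · simp [homog, mul_div_cancel₀ _ h0]

theorem lorentz_homog_self {k : ℕ} (z : USphere k) : lorentz (homog z) (homog z) = 0 := by
  have h := mem_sphere_zero_iff_norm.mp z.2
  rw [EuclideanSpace.norm_eq, Real.sqrt_eq_one] at h
  rw [lorentz_self]
  simp [homog, h]

/-- An automorphism of the sphere multiplies the Hermitian form by a constant. -/
theorem exists_lorentz_mulVec {k : ℕ} (M : Matrix (Fin (k + 1)) (Fin (k + 1)) ℂ)
    (hM : ∀ z : USphere k, lorentz (M.mulVec (homog z)) (M.mulVec (homog z)) = 0) :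
    ∃ c : ℂ, ∀ x y, lorentz (M.mulVec x) (M.mulVec y) = c * lorentz x y := by
  -- This choice makes the defect `D` vanish at the origin vector; it also vanishes on null vectors,
  -- and these two facts force `D = 0`.
  set c := lorentz (M.mulVec (origin k)) (M.mulVec (origin k)) with hc
  set D : (Fin (k + 1) → ℂ) → (Fin (k + 1) → ℂ) → ℂ :=
    fun x y => lorentz (M.mulVec x) (M.mulVec y) - c * lorentz x y with hD
  have hal : ∀ x x' y, D (x + x') y = D x y + D x' y := fun x x' y => by
    simp only [hD, Matrix.mulVec_add, lorentz_add_left]; ring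
  have har : ∀ x y y', D x (y + y') = D x y + D x y' := fun x y y' => by
    simp only [hD, Matrix.mulVec_add, lorentz_add_right]; ring
  have hsl : ∀ (a : ℂ) x y, D (a • x) y = a * D x y := fun a x y => by
    simp only [hD, Matrix.mulVec_smul, lorentz_smul_left]; ring
  have hsr : ∀ (a : ℂ) x y, D x (a • y) = conj a * D x y := fun a x y => by
    simp only [hD, Matrix.mulVec_smul, lorentz_smul_right]; ring
  have hoo : D (origin k) (origin k) = 0 := by
    simp [hD, ← hc, lorentz_origin_right]
  have hnull : ∀ x, lorentz x x = 0 → x 0 ≠ 0 → D x x = 0 := fun x hx h0 => by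
    obtain ⟨z, hz⟩ := exists_sphere_smul hx h0
    simp only [hD]
    rw [hx, hz, Matrix.mulVec_smul, lorentz_smul_left, lorentz_smul_right, hM z]
    ring
  have hu : ∀ u : Fin (k + 1) → ℂ, u 0 = 0 →
      D (origin k) u = 0 ∧ D u (origin k) = 0 ∧ D u u = 0 := fun u hu0 => by
    by_cases hu : u = 0
    · subst hu
      have h := hsl 0 0 (origin k)
      have h' := hsr 0 (origin k) 0
      have h'' := hsl 0 0 0
      simp only [zero_smul, zero_mul, map_zero] at h h' h''
      exact ⟨h', h, h''⟩
    set r : ℝ := Real.sqrt (∑ i : Fin k, ‖u i.succ‖ ^ 2) with hr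
    have hsum : 0 ≤ ∑ i : Fin k, ‖u i.succ‖ ^ 2 := Finset.sum_nonneg fun i _ => by positivity
    have hr2 : r ^ 2 = ∑ i : Fin k, ‖u i.succ‖ ^ 2 := Real.sq_sqrt hsum
    have hr0 : (r : ℂ) ≠ 0 := by
      intro h
      rw [Complex.ofReal_eq_zero] at h
      rw [h, zero_pow two_ne_zero, eq_comm, Finset.sum_eq_zero_iff_of_nonneg
        (fun i _ => by positivity)] at hr2
      refine hu (funext fun i => Fin.cases hu0 (fun j => ?_) i)
      simpa using hr2 j (Finset.mem_univ j)
    -- The vector ζr·origin + u is null for every unimodular ζ; the values ζ = 1, −1, i separate the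
    -- three unknown entries of `D`.
    have key : ∀ ζ : ℂ, ‖ζ‖ = 1 →
        ζ * r * D (origin k) u + conj ζ * r * D u (origin k) + D u u = 0 := fun ζ hζ => by
      have h := hnull ((ζ * r) • origin k + u) (by
        rw [lorentz_self]
        simp [hu0, hζ, hr2]) (by
        have : ζ ≠ 0 := by rintro rfl; simp at hζ
        simpa [hu0] using ⟨this, fun h => hr0 (by simp [h])⟩)
      simp only [hal, har, hsl, hsr, hoo, map_mul, Complex.conj_ofReal] at h
      linear_combination h
    have h1 := key 1 (by simp)
    have h2 := key (-1) (by simp)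
    have h3 := key Complex.I (by simp)
    simp only [map_one, map_neg, Complex.conj_I] at h1 h2 h3
    have huu : D u u = 0 := by linear_combination (h1 + h2) / 2
    have e1 : (r : ℂ) * (D (origin k) u + D u (origin k)) = 0 := by
      linear_combination (h1 - h2) / 2
    have e2 : (Complex.I * r : ℂ) * (D (origin k) u - D u (origin k)) = 0 := by
      linear_combination h3 - huu
    have e1' := (mul_eq_zero.mp e1).resolve_left hr0
    have e2' := (mul_eq_zero.mp e2).resolve_left (mul_ne_zero Complex.I_ne_zero hr0)
    exact ⟨by linear_combination (e1' + e2') / 2, by linear_combination (e1' - e2') / 2, huu⟩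
  have hself : ∀ x, D x x = 0 := fun x => by
    have hx : x = x 0 • origin k + (x - x 0 • origin k) := by simp
    obtain ⟨h1, h2, h3⟩ := hu (x - x 0 • origin k) (by simp)
    rw [hx]
    simp only [hal, har, hsl, hsr, hoo]
    generalize x - x 0 • origin k = v at *
    rw [h1, h2, h3]; ring
  refine ⟨c, fun x y => ?_⟩
  -- Polarization: a sesquilinear form that vanishes on the diagonal is zero.
  have h1 := hself (x + y)
  have h2 := hself (x + Complex.I • y)
  simp only [hal, har, hsl, hsr, hself, Complex.conj_I] at h1 h2
  have h3 : D x y = 0 := by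
    linear_combination (h1 + Complex.I * h2) / 2 -
      (D y x - D x y) / 2 * Complex.I_sq
  exact sub_eq_zero.mp h3

/-- The data of an automorphism in homogeneous coordinates. -/
theorem IsSphereAut.exists_form {k : ℕ} {φ : USphere k ≃ USphere k} (hφ : IsSphereAut φ) :
    ∃ (M : Matrix (Fin (k + 1)) (Fin (k + 1)) ℂ) (c : ℂ), IsUnit M.det ∧ c ≠ 0 ∧
      (∀ z, ∃ a : ℂ, a ≠ 0 ∧ M.mulVec (homog z) = a • homog (φ z)) ∧
      ∀ x y, lorentz (M.mulVec x) (M.mulVec y) = c * lorentz x y := by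
  obtain ⟨M, hM, h⟩ := hφ
  obtain ⟨c, hc⟩ := exists_lorentz_mulVec M fun z => by
    obtain ⟨a, -, ha⟩ := h z
    rw [ha, lorentz_smul_left, lorentz_smul_right, lorentz_homog_self]; simp
  refine ⟨M, c, hM, ?_, h, hc⟩
  rintro rfl
  have := hc (M⁻¹.mulVec (origin k)) (M⁻¹.mulVec (origin k))
  simp [Matrix.mulVec_mulVec, Matrix.mul_nonsing_inv M hM, lorentz_origin_right] at this

/-- For `k ≥ 2`, the multiplier of the form is positive. -/
theorem exists_pos_multiplier {k : ℕ} {M : Matrix (Fin (k + 2 + 1)) (Fin (k + 2 + 1)) ℂ} {c : ℂ}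
    (hM : IsUnit M.det) (hc : ∀ x y, lorentz (M.mulVec x) (M.mulVec y) = c * lorentz x y) :
    ∃ r : ℝ, 0 < r ∧ c = r := by
  have hcr : c = ((c.re : ℝ) : ℂ) := by
    have h := hc (origin _) (origin _)
    rw [lorentz_origin_right, origin_zero, mul_one, lorentz_self] at h
    rw [← h, Complex.ofReal_re]
  refine ⟨c.re, ?_, hcr⟩
  -- Two negative directions leave room for a combination `x` such that both `x` and `Mx` have
  -- zeroth coordinate 0. Both are then negative vectors, so the multiplier is positive. In
  -- signature (1, 1) this would fail.
  obtain ⟨x, hx0, hx, hMx⟩ : ∃ x : Fin (k + 2 + 1) → ℂ, x 0 = 0 ∧ x ≠ 0 ∧ M.mulVec x 0 = 0 := by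
    set α := M 0 (Fin.succ 0) with hα
    set β := M 0 (Fin.succ 1) with hβ
    by_cases h : α = 0
    · exact ⟨Pi.single (Fin.succ 0) 1, Pi.single_eq_of_ne (Fin.succ_ne_zero _).symm _, by simp,
        by simp only [Matrix.mulVec_single_one]; exact h⟩
    · refine ⟨Pi.single (Fin.succ 0) (-β) + Pi.single (Fin.succ 1) α, ?_, fun h' => h ?_, ?_⟩
      · rw [Pi.add_apply, Pi.single_eq_of_ne (Fin.succ_ne_zero _).symm,
          Pi.single_eq_of_ne (Fin.succ_ne_zero _).symm, add_zero]
      · have := congrFun h' (Fin.succ 1)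
        rwa [Pi.add_apply, Pi.single_eq_same, Pi.single_eq_of_ne
          ((Fin.succ_injective _).ne one_ne_zero), zero_add] at this
      · rw [Matrix.mulVec_add, Pi.add_apply]
        simp only [Matrix.mulVec_single, Pi.smul_apply, Matrix.col_apply, MulOpposite.smul_eq_mul_unop,
          MulOpposite.unop_op, ← hα, ← hβ]
        ring
  have h := hc x x
  rw [hcr, lorentz_self, lorentz_self, hx0, hMx, ← Complex.ofReal_mul, Complex.ofReal_inj] at h
  have hpos : ∀ v : Fin (k + 2 + 1) → ℂ, v 0 = 0 → v ≠ 0 → 0 < ∑ i : Fin (k + 2), ‖v i.succ‖ ^ 2 := by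
    intro v hv0 hv
    refine lt_of_le_of_ne (Finset.sum_nonneg fun i _ => by positivity) fun h0 => hv ?_
    rw [eq_comm, Finset.sum_eq_zero_iff_of_nonneg (fun i _ => by positivity)] at h0
    exact funext fun i => Fin.cases hv0 (fun j => by simpa using h0 j (Finset.mem_univ j)) i
  have hx1 := hpos x hx0 hx
  have hx2 := hpos _ hMx fun h0 => hx <| by
    have := congrArg (M⁻¹.mulVec) h0
    simpa [Matrix.mulVec_mulVec, Matrix.nonsing_inv_mul M hM] using this
  simp only [norm_zero] at h
  nlinarith

/-! ### Polynomials in homogeneous coordinates -/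

theorem eval_smul_of_isHomogeneous {σ : Type*} {d : ℕ} {G : MvPolynomial σ ℂ}
    (hG : G.IsHomogeneous d) (a : ℂ) (x : σ → ℂ) : eval (a • x) G = a ^ d * eval x G := by
  rw [eval_eq, eval_eq, Finset.mul_sum]
  refine Finset.sum_congr rfl fun m hm => ?_
  have hd : m.degree = d := by
    by_contra h
    exact mem_support_iff.mp hm (hG.coeff_eq_zero h)
  simp only [Pi.smul_apply, smul_eq_mul, mul_pow, Finset.prod_mul_distrib,
    Finset.prod_pow_eq_pow_sum]
  rw [← hd, Finsupp.degree_apply]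
  ring

/-- A homogeneous polynomial that vanishes on the sphere is zero. -/
theorem eq_zero_of_eval_homog {n d : ℕ} {G : MvPolynomial (Fin (n + 1 + 1)) ℂ}
    (hG : G.IsHomogeneous d) (h : ∀ z : USphere (n + 1), eval (homog z) G = 0) : G = 0 := by
  have hnull : ∀ x, lorentz x x = 0 → x 0 ≠ 0 → eval x G = 0 := fun x hx h0 => by
    obtain ⟨z, hz⟩ := exists_sphere_smul hx h0
    rw [hz, eval_smul_of_isHomogeneous hG, h, mul_zero]
  -- With the other coordinates fixed, `G` is a polynomial in the zeroth one that vanishes on a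
  -- whole circle of radius r > 0, hence identically.
  have hall : ∀ x : Fin (n + 1 + 1) → ℂ, x (Fin.succ 0) ≠ 0 → eval x G = 0 := fun x hx => by
    set r : ℝ := Real.sqrt (∑ i : Fin (n + 1), ‖x i.succ‖ ^ 2) with hr
    have hpos : 0 < ∑ i : Fin (n + 1), ‖x i.succ‖ ^ 2 :=
      Finset.sum_pos' (fun i _ => by positivity) ⟨0, Finset.mem_univ _, by positivity⟩
    have hr2 : r ^ 2 = ∑ i : Fin (n + 1), ‖x i.succ‖ ^ 2 := Real.sq_sqrt hpos.le
    have hr0 : 0 < r := Real.sqrt_pos.mpr hpos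
    let g : Polynomial ℂ := aeval (Fin.cons Polynomial.X fun i => Polynomial.C (x i.succ)) G
    have hg : ∀ a : ℂ, g.eval a = eval (Fin.cons a fun i => x i.succ) G := fun a => by
      simp only [g]
      clear hG h hnull
      induction G using MvPolynomial.induction_on with
      | C c => simp
      | add p q hp hq => simp only [map_add, Polynomial.eval_add, *]
      | mul_X p i hp =>
        rw [map_mul, map_mul, Polynomial.eval_mul, hp, aeval_X, eval_X]
        refine congrArg _ (Fin.cases ?_ (fun j => ?_) i) <;> simp
    have hg0 : g = 0 := by
      refine Polynomial.eq_zero_of_infinite_isRoot g (Set.Infinite.mono (s := Metric.sphere 0 r)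
        (fun a ha => ?_) ?_)
      · rw [mem_sphere_zero_iff_norm] at ha
        rw [Set.mem_ofPred_eq, Polynomial.IsRoot, hg]
        refine hnull _ ?_ ?_
        · rw [lorentz_self]; simp [ha, hr2]
        · rintro h0
          rw [Fin.cons_zero] at h0
          rw [h0, norm_zero] at ha
          exact hr0.ne ha
      · have hr : (r : ℂ) ∈ Metric.sphere (0 : ℂ) r := by simp [abs_of_pos hr0]
        have hr' : (-r : ℂ) ∈ Metric.sphere (0 : ℂ) r := by simp [abs_of_pos hr0]
        refine (isPreconnected_sphere (by simp) (0 : ℂ) r).infinite_of_nontrivial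
          ⟨_, hr, _, hr', fun h => hr0.ne' ?_⟩
        rwa [self_eq_neg, Complex.ofReal_eq_zero] at h
    have := hg (x 0)
    rw [hg0, Polynomial.eval_zero] at this
    rw [this]; congr 1
    exact congrArg _ (Fin.cons_self_tail x).symm
  -- Multiplying by a variable absorbs the points where the circle might degenerate.
  have hX : G * X (Fin.succ 0) = 0 := MvPolynomial.funext fun x => by
    rw [map_mul, eval_X, map_zero]
    by_cases hx : x (Fin.succ 0) = 0
    · rw [hx, mul_zero]
    · rw [hall x hx, zero_mul]
  exact (mul_eq_zero.mp hX).resolve_right (X_ne_zero _)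

/-- Linear substitution of the variables. -/
noncomputable def linSubst {m : ℕ} (M : Matrix (Fin m) (Fin m) ℂ) :
    MvPolynomial (Fin m) ℂ →ₐ[ℂ] MvPolynomial (Fin m) ℂ :=
  aeval fun i => ∑ j, C (M i j) * X j

theorem eval_linSubst {m : ℕ} (M : Matrix (Fin m) (Fin m) ℂ) (x : Fin m → ℂ)
    (G : MvPolynomial (Fin m) ℂ) : eval x (linSubst M G) = eval (M.mulVec x) G := by
  induction G using MvPolynomial.induction_on with
  | C c => simp [linSubst]
  | add p q hp hq => simp only [map_add, *]
  | mul_X p i hp =>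
    rw [map_mul, map_mul, hp, map_mul]
    simp [linSubst, Matrix.mulVec, dotProduct]

theorem linSubst_linSubst {m : ℕ} (M M' : Matrix (Fin m) (Fin m) ℂ)
    (G : MvPolynomial (Fin m) ℂ) : linSubst M (linSubst M' G) = linSubst (M' * M) G :=
  MvPolynomial.funext fun x => by simp [eval_linSubst, Matrix.mulVec_mulVec]

theorem linSubst_one {m : ℕ} (G : MvPolynomial (Fin m) ℂ) : linSubst 1 G = G :=
  MvPolynomial.funext fun x => by simp [eval_linSubst]

theorem isHomogeneous_linSubst {m d : ℕ} (M : Matrix (Fin m) (Fin m) ℂ)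
    {G : MvPolynomial (Fin m) ℂ} (hG : G.IsHomogeneous d) : (linSubst M G).IsHomogeneous d := by
  have := hG.aeval (fun i => ∑ j, C (M i j) * X j) (n := 1) fun i =>
    IsHomogeneous.sum _ _ _ fun j _ => isHomogeneous_C_mul_X _ _
  simpa [linSubst] using this

theorem isRelPrime_linSubst {m : ℕ} {M : Matrix (Fin m) (Fin m) ℂ} (hM : IsUnit M.det)
    {A B : MvPolynomial (Fin m) ℂ} (h : IsRelPrime A B) :
    IsRelPrime (linSubst M A) (linSubst M B) := by
  intro u hA hB
  have hi : ∀ G, linSubst M⁻¹ (linSubst M G) = G := fun G => by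
    rw [linSubst_linSubst, Matrix.mul_nonsing_inv M hM, linSubst_one]
  have hi' : ∀ G, linSubst M (linSubst M⁻¹ G) = G := fun G => by
    rw [linSubst_linSubst, Matrix.nonsing_inv_mul M hM, linSubst_one]
  have h1 := map_dvd (linSubst M⁻¹) hA
  have h2 := map_dvd (linSubst M⁻¹) hB
  rw [hi] at h1 h2
  rw [← hi' u]
  exact (h h1 h2).map _

/-- Unique factorization gives gcd(qA, qB) = q·gcd(A, B) up to units. -/
theorem dvd_of_dvd_mul_of_isRelPrime {m : ℕ} {A B q ν : MvPolynomial (Fin m) ℂ}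
    (h : IsRelPrime A B) (hA : ν ∣ q * A) (hB : ν ∣ q * B) : ν ∣ q := by
  classical
  let _ := UniqueFactorizationMonoid.toGCDMonoid (MvPolynomial (Fin m) ℂ)
  have h1 : ν ∣ gcd (q * A) (q * B) := dvd_gcd hA hB
  have hu : IsUnit (gcd A B) := h (gcd_dvd_left _ _) (gcd_dvd_right _ _)
  exact h1.trans ((gcd_mul_left' q A B).dvd.trans (hu.mul_right_dvd.mpr dvd_rfl))

/-- The homogenization to degree `d` of a polynomial of degree at most `d`. -/
noncomputable def homogenize {n : ℕ} (d : ℕ) (P : MvPolynomial (Fin n) ℂ) :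
    MvPolynomial (Fin (n + 1)) ℂ :=
  ∑ k ∈ Finset.range (d + 1), X 0 ^ (d - k) * rename Fin.succ (homogeneousComponent k P)

theorem isHomogeneous_homogenize {n : ℕ} (d : ℕ) (P : MvPolynomial (Fin n) ℂ) :
    (homogenize d P).IsHomogeneous d :=
  IsHomogeneous.sum _ _ _ fun k hk => by
    have h := (isHomogeneous_X_pow (R := ℂ) (0 : Fin (n + 1)) (d - k)).mul
      ((homogeneousComponent_isHomogeneous k P).rename_isHomogeneous (f := Fin.succ))
    rwa [Nat.sub_add_cancel (Nat.lt_succ_iff.mp (Finset.mem_range.mp hk))] at h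

theorem eval_homogenize {n d : ℕ} {P : MvPolynomial (Fin n) ℂ} (hP : P.totalDegree ≤ d)
    (z : Fin n → ℂ) : eval (Fin.cons 1 z) (homogenize d P) = eval z P := by
  have hsum : ∑ k ∈ Finset.range (d + 1), homogeneousComponent k P = P := by
    conv_rhs => rw [← sum_homogeneousComponent P]
    refine (Finset.sum_subset (fun k hk => ?_) fun k _ hk => ?_).symm
    · simp only [Finset.mem_range] at hk ⊢; omega
    · simp only [Finset.mem_range] at hk
      exact homogeneousComponent_eq_zero _ _ (by omega)
  conv_rhs => rw [← hsum]
  simp only [homogenize, map_sum, map_mul, map_pow, eval_X, Fin.cons_zero, one_pow, one_mul,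
    eval_rename]
  rfl

theorem homogenize_of_isHomogeneous {n d : ℕ} {P : MvPolynomial (Fin n) ℂ}
    (hP : P.IsHomogeneous d) : homogenize d P = rename Fin.succ P := by
  rw [homogenize, Finset.sum_eq_single d]
  · rw [homogeneousComponent_eq_self hP, Nat.sub_self, pow_zero, one_mul]
  · intro k _ hk
    rw [homogeneousComponent_of_mem (m := k) hP, if_neg hk]
    simp
  · simp

/-! ### Homogeneous lifts of maps of spheres -/

/-- The value of a tuple of polynomials. -/
noncomputable def evalTuple {σ ι : Type*} (Φ : ι → MvPolynomial σ ℂ) (x : σ → ℂ) : ι → ℂ :=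
  fun i => eval x (Φ i)

/-- `Φ` consists of homogeneous polynomials of degree `d` that give `f` in homogeneous
coordinates. -/
structure IsLift {n N : ℕ} (d : ℕ) (f : USphere n → USphere N)
    (Φ : Fin (N + 1) → MvPolynomial (Fin (n + 1)) ℂ) : Prop where
  homogeneous : ∀ i, (Φ i).IsHomogeneous d
  value : ∀ z, ∃ c : ℂ, c ≠ 0 ∧ evalTuple Φ (homog z) = c • homog (f z)

theorem evalTuple_smul {σ ι : Type*} {d : ℕ} {Φ : ι → MvPolynomial σ ℂ}
    (h : ∀ i, (Φ i).IsHomogeneous d) (a : ℂ) (x : σ → ℂ) :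
    evalTuple Φ (a • x) = a ^ d • evalTuple Φ x :=
  funext fun i => eval_smul_of_isHomogeneous (h i) a x

/-- Extension of a tuple by zeros. -/
def zeroExtend {N : ℕ} (K : ℕ) {α : Type*} [Zero α] (v : Fin N → α) : Fin K → α :=
  fun i => if h : (i : ℕ) < N then v ⟨i, h⟩ else 0

/-- The homogeneous coordinates of `p / q`, extended by zeros. -/
noncomputable def liftTuple {n N : ℕ} (K d : ℕ) (p : Fin N → MvPolynomial (Fin n) ℂ)
    (q : MvPolynomial (Fin n) ℂ) : Fin (K + 1) → MvPolynomial (Fin (n + 1)) ℂ :=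
  Fin.cons (homogenize d q) (zeroExtend K fun i => homogenize d (p i))

/-- Any d bounding the degrees is allowed and lowest terms are not needed, so this also covers
polynomial maps, with q = 1. -/
theorem isLift_padMap {n N K d : ℕ} (hNK : N ≤ K) {f : USphere n → USphere N}
    {p : Fin N → MvPolynomial (Fin n) ℂ} {q : MvPolynomial (Fin n) ℂ}
    (hp : ∀ i, (p i).totalDegree ≤ d) (hq : q.totalDegree ≤ d) (hq0 : ∀ z, evalAt q z ≠ 0)
    (hf : ∀ z i, (f z : EuclideanSpace ℂ (Fin N)) i = evalAt (p i) z / evalAt q z) :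
    IsLift d (padMap hNK f) (liftTuple K d p q) where
  homogeneous := Fin.cases (isHomogeneous_homogenize d q) fun i => by
    simp only [liftTuple, Fin.cons_succ, zeroExtend]
    split
    · exact isHomogeneous_homogenize d _
    · exact isHomogeneous_zero _ _ _
  value z := by
    refine ⟨evalAt q z, hq0 z, funext <| Fin.cases ?_ fun i => ?_⟩
    · simp [evalTuple, liftTuple, homog, eval_homogenize hq, evalAt]
    · simp only [evalTuple, liftTuple, homog, Fin.cons_succ, Pi.smul_apply, padMap, padVec,
        zeroExtend, smul_eq_mul]
      split
      · rw [eval_homogenize (hp _), hf, mul_div_cancel₀ _ (hq0 z), evalAt]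
      · simp

theorem lorentz_liftTuple {n N K d : ℕ} (hNK : N ≤ K) (p : Fin N → MvPolynomial (Fin n) ℂ)
    (q : MvPolynomial (Fin n) ℂ) (x y : Fin (n + 1) → ℂ) :
    lorentz (evalTuple (liftTuple K d p q) x) (evalTuple (liftTuple K d p q) y) =
      eval x (homogenize d q) * conj (eval y (homogenize d q)) -
        ∑ i, eval x (homogenize d (p i)) * conj (eval y (homogenize d (p i))) := by
  obtain ⟨k, rfl⟩ := Nat.exists_eq_add_of_le hNK
  simp [lorentz, evalTuple, liftTuple, zeroExtend, Fin.sum_univ_add]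

/-- If two maps with lifts `Φ` and `Ψ` correspond under automorphisms with matrices `M` and `T`,
then `Ψ₀ (Φ ∘ M) = ν T Ψ` with a homogeneous polynomial `ν` that divides `Ψ₀`. -/
theorem exists_factor {n K d e : ℕ} {f g : USphere (n + 1) → USphere K}
    {Φ Ψ : Fin (K + 1) → MvPolynomial (Fin (n + 1 + 1)) ℂ} (hΦ : IsLift d f Φ)
    (hΨ : IsLift e g Ψ) {i j : Fin (K + 1)} (hij : IsRelPrime (Φ i) (Φ j))
    {χ : USphere (n + 1) ≃ USphere (n + 1)} {τ : USphere K ≃ USphere K}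
    {M : Matrix (Fin (n + 1 + 1)) (Fin (n + 1 + 1)) ℂ} {T : Matrix (Fin (K + 1)) (Fin (K + 1)) ℂ}
    {c : ℂ} (hM : IsUnit M.det) (hc : c ≠ 0)
    (hχ : ∀ z, ∃ a : ℂ, a ≠ 0 ∧ M.mulVec (homog z) = a • homog (χ z))
    (hτ : ∀ z, ∃ a : ℂ, a ≠ 0 ∧ T.mulVec (homog z) = a • homog (τ z))
    (hT : ∀ x y, lorentz (T.mulVec x) (T.mulVec y) = c * lorentz x y)
    (hfg : f ∘ χ = τ ∘ g) :
    ∃ ν : MvPolynomial (Fin (n + 1 + 1)) ℂ, ν.IsHomogeneous d ∧ ν ∣ Ψ 0 ∧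
      (∀ x, lorentz (evalTuple Φ (M.mulVec x)) (T.mulVec (origin K)) = c * eval x ν) ∧
      ∀ x, eval x (Ψ 0) • evalTuple Φ (M.mulVec x) = eval x ν • T.mulVec (evalTuple Ψ x) := by
  set t := T.mulVec (origin K) with ht
  -- On the sphere Φ∘M = μ·TΨ for a scalar μ. Pairing with T·origin gives cμΨ₀, so this polynomial,
  -- linear in the entries of Φ∘M, equals μΨ₀ there.
  set ν : MvPolynomial (Fin (n + 1 + 1)) ℂ := C c⁻¹ * (C (conj (t 0)) * linSubst M (Φ 0) -
    ∑ i : Fin K, C (conj (t i.succ)) * linSubst M (Φ i.succ)) with hν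
  have hνh : ν.IsHomogeneous d :=
    (((isHomogeneous_linSubst M (hΦ.homogeneous 0)).C_mul _).sub (IsHomogeneous.sum _ _ _
      fun i _ => (isHomogeneous_linSubst M (hΦ.homogeneous i.succ)).C_mul _)).C_mul _
  have hνe : ∀ x, lorentz (evalTuple Φ (M.mulVec x)) t = c * eval x ν := fun x => by
    simp only [hν, map_mul, eval_C, map_sub, map_sum, eval_linSubst, mul_inv_cancel_left₀ hc,
      lorentz, evalTuple, mul_comm (conj _)]
  have hTΨ : ∀ i, (∑ j, C (T i j) * Ψ j).IsHomogeneous e := fun i =>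
    IsHomogeneous.sum _ _ _ fun j _ => (hΨ.homogeneous j).C_mul _
  have hTe : ∀ i x, eval x (∑ j, C (T i j) * Ψ j) = T.mulVec (evalTuple Ψ x) i := fun i x => by
    simp [Matrix.mulVec, dotProduct, evalTuple]
  have hpoly : ∀ i, Ψ 0 * linSubst M (Φ i) = ν * ∑ j, C (T i j) * Ψ j := fun i => by
    have hhom := ((hΨ.homogeneous 0).mul (isHomogeneous_linSubst M (hΦ.homogeneous i))).sub
      ((add_comm d e) ▸ hνh.mul (hTΨ i))
    refine sub_eq_zero.mp (eq_zero_of_eval_homog hhom fun z => ?_)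
    obtain ⟨a, ha, ha'⟩ := hχ z
    obtain ⟨b, hb, hb'⟩ := hΦ.value (χ z)
    obtain ⟨a₁, ha₁, ha₁'⟩ := hτ (g z)
    obtain ⟨b₁, hb₁, hb₁'⟩ := hΨ.value z
    have hfz : f (χ z) = τ (g z) := congrFun hfg z
    obtain ⟨μ, hμ⟩ : ∃ μ : ℂ, evalTuple Φ (M.mulVec (homog z)) =
        μ • T.mulVec (evalTuple Ψ (homog z)) := by
      refine ⟨a ^ d * b * (a₁⁻¹ * b₁⁻¹), ?_⟩
      rw [ha', evalTuple_smul hΦ.homogeneous, hb', hb₁', Matrix.mulVec_smul, ha₁', hfz]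
      simp only [smul_smul]
      congr 1
      field_simp
    have h1 := hνe (homog z)
    rw [hμ, lorentz_smul_left, ht, hT, lorentz_origin_right] at h1
    have h2 : eval (homog z) ν = μ * eval (homog z) (Ψ 0) :=
      mul_left_cancel₀ hc (by rw [← h1, evalTuple]; ring)
    have h3 := congrFun hμ i
    rw [map_sub, map_mul, map_mul, hTe, h2, eval_linSubst]
    simp only [evalTuple, Pi.smul_apply, smul_eq_mul] at h3 ⊢
    rw [h3]; ring
  refine ⟨ν, hνh, ?_, hνe, fun x => funext fun i => ?_⟩
  · exact dvd_of_dvd_mul_of_isRelPrime (isRelPrime_linSubst hM hij)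
      (Dvd.intro _ (hpoly i).symm) (Dvd.intro _ (hpoly j).symm)
  · have := congrArg (eval x) (hpoly i)
    rwa [map_mul, map_mul, hTe, eval_linSubst] at this

/-- The case of a polynomial map that takes the origin to the origin. -/
theorem lorentz_lift_of_polynomial {n K d e : ℕ} {f g : USphere (n + 1) → USphere K}
    {Φ Ψ : Fin (K + 1) → MvPolynomial (Fin (n + 1 + 1)) ℂ} (hΦ : IsLift d f Φ)
    (hΨ : IsLift e g Ψ) {i j : Fin (K + 1)} (hij : IsRelPrime (Φ i) (Φ j))
    (hΨ0 : Ψ 0 = X 0 ^ e) (hΨo : evalTuple Ψ (origin (n + 1)) = origin K)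
    {χ : USphere (n + 1) ≃ USphere (n + 1)} {τ : USphere K ≃ USphere K}
    {M : Matrix (Fin (n + 1 + 1)) (Fin (n + 1 + 1)) ℂ} (hM : IsUnit M.det)
    (hχ : ∀ z, ∃ a : ℂ, a ≠ 0 ∧ M.mulVec (homog z) = a • homog (χ z))
    (hτ : IsSphereAut τ) (hfg : f ∘ χ = τ ∘ g) :
    ∃ k : ℂ, ∀ x, lorentz (evalTuple Φ (M.mulVec x)) (evalTuple Φ (M.mulVec (origin (n + 1)))) =
      k * x 0 ^ d := by
  obtain ⟨T, c, -, hc, hτ', hT⟩ := hτ.exists_form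
  obtain ⟨ν, hνh, hdvd, hν, hνΦ⟩ := exists_factor hΦ hΨ hij hM hc hχ hτ' hT hfg
  rw [hΨ0] at hdvd
  have hν0 : ν ≠ 0 := ne_zero_of_dvd_ne_zero (pow_ne_zero _ (X_ne_zero _)) hdvd
  obtain ⟨l, -, hl⟩ := (dvd_prime_pow X_prime e).mp hdvd
  obtain ⟨u, hu⟩ := hl.symm
  obtain ⟨b, -, hb⟩ := isUnit_iff_eq_C_of_isReduced.mp u.isUnit
  -- A divisor of X₀^e is a constant times X₀^l, and homogeneity forces l = d.
  have hld : ν = C b * X 0 ^ d := by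
    have h1 : ν = C b * X 0 ^ l := by rw [← hu, hb, mul_comm]
    have h2 : ν.IsHomogeneous l := by
      rw [h1]; exact isHomogeneous_C_mul_X_pow b 0 l
    rw [hνh.inj_right h2 hν0, h1]
  -- At the origin the factorization reads Φ(M·origin) = ν(origin)·T·origin, so pairing with
  -- Φ(M·origin) is pairing with T·origin, which gives ν.
  have ho := hνΦ (origin (n + 1))
  rw [hΨ0, hΨo] at ho
  simp only [map_pow, eval_X, origin_zero, one_pow, one_smul] at ho
  refine ⟨conj (eval (origin (n + 1)) ν) * (c * b), fun x => ?_⟩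
  rw [ho, lorentz_smul_right, hν, hld]
  simp; ring

/-- The case of two maps whose lifts have the same degree. -/
theorem lorentz_lift_of_same_degree {n K d : ℕ} {f g : USphere (n + 1) → USphere K}
    {Φ Ψ : Fin (K + 1) → MvPolynomial (Fin (n + 1 + 1)) ℂ} (hΦ : IsLift d f Φ)
    (hΨ : IsLift d g Ψ) {i j : Fin (K + 1)} (hij : IsRelPrime (Φ i) (Φ j)) (hΨ0 : Ψ 0 ≠ 0)
    {χ : USphere (n + 1) ≃ USphere (n + 1)} {τ : USphere K ≃ USphere K}
    {M : Matrix (Fin (n + 1 + 1)) (Fin (n + 1 + 1)) ℂ} (hM : IsUnit M.det)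
    (hχ : ∀ z, ∃ a : ℂ, a ≠ 0 ∧ M.mulVec (homog z) = a • homog (χ z))
    (hτ : IsSphereAut τ) (hfg : f ∘ χ = τ ∘ g) :
    ∃ k : ℂ, ∀ x y, lorentz (evalTuple Φ (M.mulVec x)) (evalTuple Φ (M.mulVec y)) =
      k * lorentz (evalTuple Ψ x) (evalTuple Ψ y) := by
  obtain ⟨T, c, -, hc, hτ', hT⟩ := hτ.exists_form
  obtain ⟨ν, hνh, ⟨κ, hκ⟩, hν, hνΦ⟩ := exists_factor hΦ hΨ hij hM hc hχ hτ' hT hfg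
  have hν0 : ν ≠ 0 := by rintro rfl; exact hΨ0 (by simp [hκ])
  have hκ0 : κ ≠ 0 := by rintro rfl; exact hΨ0 (by simp [hκ])
  -- Both ν and Ψ₀ have degree d, so the cofactor κ is constant.
  have hdeg := totalDegree_mul_of_isDomain hν0 hκ0
  rw [← hκ, (hΨ.homogeneous 0).totalDegree hΨ0, hνh.totalDegree hν0] at hdeg
  have hκC := totalDegree_eq_zero_iff_eq_C.mp (show κ.totalDegree = 0 by omega)
  set b := coeff 0 κ
  have hb : b ≠ 0 := by rintro h; rw [h, map_zero] at hκC; exact hκ0 hκC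
  have hpoly : ∀ i, C b * linSubst M (Φ i) = ∑ j, C (T i j) * Ψ j := fun i => by
    refine mul_left_cancel₀ hν0 (MvPolynomial.funext fun x => ?_)
    have h := congrFun (hνΦ x) i
    rw [hκ, hκC] at h
    simp only [evalTuple, Pi.smul_apply, smul_eq_mul, map_mul, eval_C, Matrix.mulVec,
      dotProduct] at h
    simp only [map_mul, eval_C, eval_linSubst, map_sum]
    rw [← h]
    ring
  have key : ∀ x, evalTuple Φ (M.mulVec x) = b⁻¹ • T.mulVec (evalTuple Ψ x) := fun x =>
    funext fun i => by
      have h := congrArg (eval x) (hpoly i)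
      simp only [map_mul, eval_C, eval_linSubst, map_sum] at h
      rw [Pi.smul_apply, smul_eq_mul, eq_inv_mul_iff_mul_eq₀ hb]
      exact h
  refine ⟨b⁻¹ * conj b⁻¹ * c, fun x y => ?_⟩
  rw [key x, key y, lorentz_smul_left, lorentz_smul_right, hT]; ring

/-! ### A two-parameter family of maps of degree three -/

/-- The standard Hermitian product on `ℂⁿ`, linear in the first argument. -/
noncomputable def herm {n : ℕ} (z w : Fin n → ℂ) : ℂ := ∑ i, z i * conj (w i)

theorem herm_smul_left {n : ℕ} (a : ℂ) (z w : Fin n → ℂ) : herm (a • z) w = a * herm z w := by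
  simp only [herm, Pi.smul_apply, smul_eq_mul, Finset.mul_sum, mul_assoc]

theorem herm_self {n : ℕ} (z : Fin n → ℂ) : herm z z = ((∑ i, ‖z i‖ ^ 2 : ℝ) : ℂ) := by
  simp [herm, Complex.mul_conj']

theorem lorentz_cons {n : ℕ} (z w : Fin n → ℂ) :
    lorentz (Fin.cons 1 z) (Fin.cons 1 w) = 1 - herm z w := by
  simp [lorentz, herm]

theorem herm_sphere {n : ℕ} (z : USphere n) :
    herm (fun i => (z : EuclideanSpace ℂ (Fin n)) i) (fun i => (z : EuclideanSpace ℂ (Fin n)) i) =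
      1 := by
  have h := lorentz_homog_self z
  rw [homog, lorentz_cons, sub_eq_zero] at h
  exact h.symm

/-- The parameters `t` of the family. -/
def region : Set (ℝ × ℝ) := {t | 0 < t.1 ∧ 0 < t.2 ∧ t.1 ^ 2 + t.2 ^ 2 < 1}

/-- The coefficient of the linear terms. -/
noncomputable def linCoeff (t : ℝ × ℝ) : ℝ := Real.sqrt (1 - t.1 ^ 2 - t.2 ^ 2)

/-- The coefficient of the generic cubic terms. -/
noncomputable def cubeCoeff (t : ℝ × ℝ) : ℝ := Real.sqrt (t.1 ^ 2 + t.2 ^ 2)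

/-- The coefficient of the quadratic term of the denominator. -/
noncomputable def quadCoeff (t : ℝ × ℝ) : ℝ := linCoeff t * t.2

/-- The index set of the components. -/
abbrev Comp (m : ℕ) : Type := Unit ⊕ Fin (m + 2) ⊕ Fin (m + 2) × Fin (m + 2) × Fin (m + 2)

/-- The numerators, indexed by `Comp m`. -/
noncomputable def numComp (m : ℕ) (t : ℝ × ℝ) : Comp m → MvPolynomial (Fin (m + 2)) ℂ
  | Sum.inl _ => C (quadCoeff t : ℂ) * (X 0 * X 1)
  | Sum.inr (Sum.inl j) => C (linCoeff t : ℂ) * X j + C (t.2 : ℂ) * (X 0 * X 1 * X j)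
  | Sum.inr (Sum.inr ijk) =>
      C ((if ijk.2.1 = 0 ∧ ijk.2.2 = 1 then t.1 else cubeCoeff t : ℝ) : ℂ) *
        (X ijk.1 * X ijk.2.1 * X ijk.2.2)

/-- The numerators. -/
noncomputable def num (m : ℕ) (t : ℝ × ℝ) (i : Fin (Fintype.card (Comp m))) :
    MvPolynomial (Fin (m + 2)) ℂ :=
  numComp m t ((Fintype.equivFin (Comp m)).symm i)

/-- The denominator. -/
noncomputable def den (m : ℕ) (t : ℝ × ℝ) : MvPolynomial (Fin (m + 2)) ℂ :=
  1 + C (quadCoeff t : ℂ) * (X 0 * X 1)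

theorem isOpen_region : IsOpen region :=
  (isOpen_lt continuous_const continuous_fst).inter
    ((isOpen_lt continuous_const continuous_snd).inter
      (isOpen_lt (f := fun t : ℝ × ℝ => t.1 ^ 2 + t.2 ^ 2) (by fun_prop) continuous_const))

theorem linCoeff_pos {t : ℝ × ℝ} (ht : t ∈ region) : 0 < linCoeff t :=
  Real.sqrt_pos.mpr (by linarith [ht.2.2])

theorem linCoeff_sq {t : ℝ × ℝ} (ht : t ∈ region) : linCoeff t ^ 2 = 1 - t.1 ^ 2 - t.2 ^ 2 :=
  Real.sq_sqrt (by linarith [ht.2.2])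

theorem cubeCoeff_sq (t : ℝ × ℝ) : cubeCoeff t ^ 2 = t.1 ^ 2 + t.2 ^ 2 :=
  Real.sq_sqrt (by positivity)

theorem cubeCoeff_pos {t : ℝ × ℝ} (ht : t ∈ region) : 0 < cubeCoeff t :=
  Real.sqrt_pos.mpr (by have := ht.1; positivity)

theorem quadCoeff_pos {t : ℝ × ℝ} (ht : t ∈ region) : 0 < quadCoeff t :=
  mul_pos (linCoeff_pos ht) ht.2.1

/-- Twice the product λt₂ is at most λ² + t₂² = 1 − t₁². The bound keeps the denominator zero-free
on the sphere and is needed again to locate the center. -/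
theorem quadCoeff_lt_one {t : ℝ × ℝ} (ht : t ∈ region) : quadCoeff t < 1 := by
  have := linCoeff_sq ht
  have := ht.1
  rw [quadCoeff]
  nlinarith [sq_nonneg (linCoeff t - t.2)]

theorem eq_of_coeff_eq {s t : ℝ × ℝ} (hs : s ∈ region) (ht : t ∈ region)
    (h1 : quadCoeff s = quadCoeff t) (h2 : cubeCoeff s ^ 2 = cubeCoeff t ^ 2) : s = t := by
  rw [cubeCoeff_sq, cubeCoeff_sq] at h2
  have h3 : linCoeff s = linCoeff t := by
    rw [linCoeff, linCoeff]; congr 1; linarith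
  have h4 : s.2 = t.2 := by
    rw [quadCoeff, quadCoeff, h3] at h1
    exact mul_left_cancel₀ (linCoeff_pos ht).ne' h1
  have h5 : s.1 = t.1 := by
    rw [h4] at h2
    exact (sq_eq_sq₀ hs.1.le ht.1.le).mp (by linarith)
  exact Prod.ext h5 h4

theorem contDiffOn_coeff_num (m : ℕ) (i : Fin (Fintype.card (Comp m))) (e : Fin (m + 2) →₀ ℕ) :
    ContDiffOn ℝ ∞ (fun t => (num m t i).coeff e) region := by
  have hlin : ContDiffOn ℝ ∞ linCoeff region := ContDiffOn.sqrt (by fun_prop) fun t ht => by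
    have := ht.2.2; linarith
  have hcube : ContDiffOn ℝ ∞ cubeCoeff region := ContDiffOn.sqrt (by fun_prop) fun t ht => by
    have := ht.1; positivity
  have hof : ∀ {g : ℝ × ℝ → ℝ}, ContDiffOn ℝ ∞ g region →
      ContDiffOn ℝ ∞ (fun t => (g t : ℂ)) region :=
    fun hg => Complex.ofRealCLM.contDiff.comp_contDiffOn hg
  simp only [num]
  rcases (Fintype.equivFin (Comp m)).symm i with _ | j | ⟨i, j, k⟩
  · simp only [numComp, coeff_C_mul]
    exact (hof (hlin.mul contDiffOn_snd)).mul contDiffOn_const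
  · simp only [numComp, coeff_C_mul, coeff_add]
    exact ((hof hlin).mul contDiffOn_const).add ((hof contDiffOn_snd).mul contDiffOn_const)
  · simp only [numComp, coeff_C_mul]
    refine ContDiffOn.mul ?_ contDiffOn_const
    split_ifs
    exacts [hof contDiffOn_fst, hof hcube]

theorem contDiffOn_coeff_den (m : ℕ) (e : Fin (m + 2) →₀ ℕ) :
    ContDiffOn ℝ ∞ (fun t => (den m t).coeff e) region := by
  have hlin : ContDiffOn ℝ ∞ linCoeff region := ContDiffOn.sqrt (by fun_prop) fun t ht => by
    have := ht.2.2; linarith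
  simp only [den, coeff_C_mul, coeff_add]
  exact contDiffOn_const.add
    ((Complex.ofRealCLM.contDiff.comp_contDiffOn (hlin.mul contDiffOn_snd)).mul contDiffOn_const)

/-- The polarization of `|q|² - |p|²`. -/
theorem den_mul_sub_num {t : ℝ × ℝ} (ht : t ∈ region) {m : ℕ} (z w : Fin (m + 2) → ℂ) :
    eval z (den m t) * conj (eval w (den m t)) -
        ∑ i, eval z (num m t i) * conj (eval w (num m t i)) =
      (1 - herm z w) * (1 + quadCoeff t * (z 0 * z 1) + quadCoeff t * conj (w 0 * w 1) +
        cubeCoeff t ^ 2 * (herm z w + herm z w ^ 2)) := by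
  have h1 : ∑ i, eval z (num m t i) * conj (eval w (num m t i)) =
      ∑ i, eval z (numComp m t i) * conj (eval w (numComp m t i)) :=
    Equiv.sum_comp (Fintype.equivFin (Comp m)).symm
      fun i => eval z (numComp m t i) * conj (eval w (numComp m t i))
  -- The cross terms of this product carry λt₂ = `quadCoeff t`, matching the linear terms of |1 + s
  -- z₀z₁|² − |s z₀z₁|²; this produces the factor 1 − ⟨z,w⟩ in front of them.
  have h2 : ∑ j, eval z (numComp m t (Sum.inr (Sum.inl j))) *
      conj (eval w (numComp m t (Sum.inr (Sum.inl j)))) =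
      herm z w * ((linCoeff t + t.2 * (z 0 * z 1)) *
        (linCoeff t + t.2 * conj (w 0 * w 1))) := by
    rw [herm, Finset.sum_mul]
    refine Finset.sum_congr rfl fun j _ => ?_
    simp [numComp]; ring
  -- Lowering the coefficient of z_i z₀z₁ from `cubeCoeff t` to t₁ removes exactly the t₂² term that
  -- the preceding sum contributes.
  have h3 : ∑ ijk, eval z (numComp m t (Sum.inr (Sum.inr ijk))) *
      conj (eval w (numComp m t (Sum.inr (Sum.inr ijk)))) =
      herm z w * (cubeCoeff t ^ 2 * herm z w ^ 2 -
        t.2 ^ 2 * (z 0 * z 1 * conj (w 0 * w 1))) := by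
    have hc : (cubeCoeff t : ℂ) ^ 2 = t.1 ^ 2 + t.2 ^ 2 := by exact_mod_cast cubeCoeff_sq t
    have hterm : ∀ i j k, eval z (numComp m t (Sum.inr (Sum.inr (i, j, k)))) *
        conj (eval w (numComp m t (Sum.inr (Sum.inr (i, j, k))))) =
        z i * conj (w i) * (cubeCoeff t ^ 2 * ((z j * conj (w j)) * (z k * conj (w k))) -
          if j = 0 then if k = 1 then (t.2 : ℂ) ^ 2 * (z 0 * z 1 * conj (w 0 * w 1)) else 0
          else 0) := fun i j k => by
      by_cases hj : j = 0
      · by_cases hk : k = 1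
        · subst hj hk
          simp [numComp, hc]; ring
        · simp [numComp, hj, hk]; ring
      · simp [numComp, hj]; ring
    simp only [Fintype.sum_prod_type, hterm]
    simp only [← Finset.mul_sum, Finset.sum_sub_distrib, ← Finset.sum_mul]
    simp [herm]
    simp only [← Finset.sum_mul]
    ring
  rw [h1, Fintype.sum_sum_type, Fintype.sum_sum_type, h2, h3]
  -- With x = ⟨z,w⟩, this allows 1 − (1 − β)x − βx³ = (1 − x)(1 + βx + βx²).
  have hl : (linCoeff t : ℂ) ^ 2 = 1 - cubeCoeff t ^ 2 := by
    have := linCoeff_sq ht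
    have h' := cubeCoeff_sq t
    exact_mod_cast (by linarith : linCoeff t ^ 2 = 1 - cubeCoeff t ^ 2)
  simp [numComp, den, quadCoeff]
  linear_combination (-herm z w) * hl

theorem totalDegree_num_le (m : ℕ) (t : ℝ × ℝ) (i : Fin (Fintype.card (Comp m))) :
    (num m t i).totalDegree ≤ 3 := by
  have hX : ∀ i j k : Fin (m + 2), (X i * X j * X k : MvPolynomial (Fin (m + 2)) ℂ).IsHomogeneous 3 :=
    fun i j k => ((isHomogeneous_X ℂ i).mul (isHomogeneous_X ℂ j)).mul (isHomogeneous_X ℂ k)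
  have hX2 : (X 0 * X 1 : MvPolynomial (Fin (m + 2)) ℂ).IsHomogeneous 2 :=
    (isHomogeneous_X ℂ _).mul (isHomogeneous_X ℂ _)
  rw [num]
  rcases (Fintype.equivFin (Comp m)).symm i with _ | j | ⟨i, j, k⟩
  · exact (hX2.C_mul _).totalDegree_le.trans (by norm_num)
  · exact (totalDegree_add _ _).trans (max_le
      (((isHomogeneous_X ℂ j).C_mul _).totalDegree_le.trans (by norm_num))
      ((hX 0 1 j).C_mul _).totalDegree_le)
  · exact ((hX i j k).C_mul _).totalDegree_le

theorem totalDegree_den_le (m : ℕ) (t : ℝ × ℝ) : (den m t).totalDegree ≤ 3 :=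
  (totalDegree_add _ _).trans (max_le (by simp)
    ((((isHomogeneous_X ℂ 0).mul (isHomogeneous_X ℂ 1)).C_mul _).totalDegree_le.trans
      (by norm_num)))

/-- The index of the component that is a multiple of the cube of the coordinate `j`. -/
noncomputable def cubeIndex (m : ℕ) (j : Fin (m + 2)) : Fin (Fintype.card (Comp m)) :=
  Fintype.equivFin (Comp m) (Sum.inr (Sum.inr (j, j, j)))

/-- Pure cubes avoid the exceptional coefficient. Two of them give coprimality, and one shows that
the degree is exactly three. -/
theorem num_cubeIndex (m : ℕ) (t : ℝ × ℝ) (j : Fin (m + 2)) :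
    num m t (cubeIndex m j) = C (cubeCoeff t : ℂ) * X j ^ 3 := by
  have h : ¬ (j = 0 ∧ j = 1) := by rintro ⟨rfl, h⟩; exact zero_ne_one h
  simp only [num, cubeIndex, Equiv.symm_apply_apply, numComp, if_neg h]
  ring

theorem isRelPrime_C_mul_X_pow {σ : Type*} {i j : σ} (hij : i ≠ j) {a b : ℂ} (ha : a ≠ 0)
    (hb : b ≠ 0) (k l : ℕ) :
    IsRelPrime (C a * X i ^ k : MvPolynomial σ ℂ) (C b * X j ^ l) := by
  have hX : IsRelPrime (X i : MvPolynomial σ ℂ) (X j) := by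
    rw [X_prime.irreducible.isRelPrime_iff_not_dvd]
    simpa [X_dvd_X] using hij
  have hC : ∀ {c : ℂ}, c ≠ 0 → IsUnit (C c : MvPolynomial σ ℂ) := fun hc => hc.isUnit.map C
  exact fun u hu hv => (hX.pow : IsRelPrime (X i ^ k) (X j ^ l))
    ((hC ha).dvd_mul_left.mp hu) ((hC hb).dvd_mul_left.mp hv)

theorem eval_den_ne_zero {t : ℝ × ℝ} (ht : t ∈ region) {m : ℕ} (z : USphere (m + 2)) :
    evalAt (den m t) z ≠ 0 := by
  intro h
  have hz : ∀ i, ‖(z : EuclideanSpace ℂ (Fin (m + 2))) i‖ ≤ 1 := fun i =>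
    (PiLp.norm_apply_le _ i).trans (mem_sphere_zero_iff_norm.mp z.2).le
  simp only [evalAt, den, map_add, map_one, map_mul, eval_C, eval_X] at h
  have h' := congrArg norm (eq_neg_of_add_eq_zero_left h)
  rw [norm_one, norm_neg, norm_mul, norm_mul, Complex.norm_real,
    Real.norm_of_nonneg (quadCoeff_pos ht).le] at h'
  have h1 := mul_le_one₀ (hz 0) (norm_nonneg _) (hz 1)
  nlinarith [quadCoeff_pos ht, quadCoeff_lt_one ht]

theorem exists_representsCRMap {t : ℝ × ℝ} (ht : t ∈ region) (m : ℕ) :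
    ∃ f : USphere (m + 2) → USphere (Fintype.card (Comp m)),
      RepresentsCRMap 3 (num m t) (den m t) f := by
  have hb : (cubeCoeff t : ℂ) ≠ 0 := by exact_mod_cast (cubeCoeff_pos ht).ne'
  refine ⟨fun z => ⟨WithLp.toLp 2 fun i => evalAt (num m t i) z / evalAt (den m t) z, ?_⟩,
    ⟨fun h hp _ => ?_, ?_, eval_den_ne_zero ht, fun z i => rfl⟩⟩
  · have h := den_mul_sub_num ht (fun i => (z : EuclideanSpace ℂ (Fin (m + 2))) i)
      (fun i => (z : EuclideanSpace ℂ (Fin (m + 2))) i)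
    rw [herm_sphere, sub_self, zero_mul, sub_eq_zero] at h
    simp only [Complex.mul_conj'] at h
    have h' : ‖evalAt (den m t) z‖ ^ 2 = ∑ i, ‖evalAt (num m t i) z‖ ^ 2 := by
      exact_mod_cast h
    rw [mem_sphere_zero_iff_norm, EuclideanSpace.norm_eq, Real.sqrt_eq_one]
    simp only [norm_div, div_pow, ← Finset.sum_div]
    rw [← h', div_self]
    simpa using eval_den_ne_zero ht z
  · have h0 := hp (cubeIndex m 0)
    have h1 := hp (cubeIndex m 1)
    rw [num_cubeIndex] at h0 h1
    exact isRelPrime_C_mul_X_pow zero_ne_one hb hb 3 3 h0 h1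
  · refine le_antisymm (max_le (Finset.sup_le fun i _ => totalDegree_num_le m t i)
      (totalDegree_den_le m t)) (le_max_of_le_left ?_)
    have h := Finset.le_sup (f := fun i => (num m t i).totalDegree) (Finset.mem_univ (cubeIndex m 0))
    refine le_trans (le_of_eq ?_) h
    rw [num_cubeIndex]
    exact ((isHomogeneous_C_mul_X_pow _ _ _).totalDegree (mul_ne_zero
      (by simpa using (cubeCoeff_pos ht).ne') (pow_ne_zero _ (X_ne_zero _)))).symm

/-! ### Invariants of the family -/

/-- The lift of a map of the family, extended by zeros to the target dimension `K`. -/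
noncomputable def famLift (m : ℕ) (t : ℝ × ℝ) (K : ℕ) :
    Fin (K + 1) → MvPolynomial (Fin (m + 2 + 1)) ℂ :=
  liftTuple K 3 (num m t) (den m t)

theorem lorentz_famLift {t : ℝ × ℝ} (ht : t ∈ region) {m K : ℕ}
    (hK : Fintype.card (Comp m) ≤ K) (z w : Fin (m + 2) → ℂ) :
    lorentz (evalTuple (famLift m t K) (Fin.cons 1 z))
        (evalTuple (famLift m t K) (Fin.cons 1 w)) =
      (1 - herm z w) * (1 + quadCoeff t * (z 0 * z 1) + quadCoeff t * conj (w 0 * w 1) +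
        cubeCoeff t ^ 2 * (herm z w + herm z w ^ 2)) := by
  rw [famLift, lorentz_liftTuple hK, ← den_mul_sub_num ht]
  simp only [eval_homogenize (totalDegree_den_le m t), eval_homogenize (totalDegree_num_le m t _)]

theorem RepresentsCRMap.isLift_famLift {m K : ℕ} {t : ℝ × ℝ}
    {f : USphere (m + 2) → USphere (Fintype.card (Comp m))}
    (hf : RepresentsCRMap 3 (num m t) (den m t) f) (hK : Fintype.card (Comp m) ≤ K) :
    IsLift 3 (padMap hK f) (famLift m t K) :=
  isLift_padMap hK (totalDegree_num_le m t) (totalDegree_den_le m t) hf.denom_ne_zero hf.value_eq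

theorem famLift_cubeIndex (m : ℕ) (t : ℝ × ℝ) {K : ℕ} (hK : Fintype.card (Comp m) ≤ K)
    (j : Fin (m + 2)) : famLift m t K (Fin.succ (Fin.castLE hK (cubeIndex m j))) =
      C (cubeCoeff t : ℂ) * X j.succ ^ 3 := by
  have h : (Fin.castLE hK (cubeIndex m j) : ℕ) < Fintype.card (Comp m) := (cubeIndex m j).2
  rw [famLift, liftTuple, Fin.cons_succ, zeroExtend, dif_pos h]
  change homogenize 3 (num m t (cubeIndex m j)) = _
  rw [num_cubeIndex, homogenize_of_isHomogeneous (isHomogeneous_C_mul_X_pow _ _ _)]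
  simp

theorem isRelPrime_famLift {t : ℝ × ℝ} (ht : t ∈ region) {m K : ℕ}
    (hK : Fintype.card (Comp m) ≤ K) :
    IsRelPrime (famLift m t K (Fin.succ (Fin.castLE hK (cubeIndex m 0))))
      (famLift m t K (Fin.succ (Fin.castLE hK (cubeIndex m 1)))) := by
  have hb : (cubeCoeff t : ℂ) ≠ 0 := by exact_mod_cast (cubeCoeff_pos ht).ne'
  rw [famLift_cubeIndex, famLift_cubeIndex]
  exact isRelPrime_C_mul_X_pow ((Fin.succ_injective _).ne zero_ne_one) hb hb 3 3

theorem homogeneous_famLift (m : ℕ) (t : ℝ × ℝ) (K : ℕ) (i : Fin (K + 1)) :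
    (famLift m t K i).IsHomogeneous 3 := by
  refine Fin.cases (isHomogeneous_homogenize _ _) (fun i => ?_) i
  simp only [famLift, liftTuple, Fin.cons_succ, zeroExtend]
  split
  · exact isHomogeneous_homogenize _ _
  · exact isHomogeneous_zero _ _ _

/-- The image of the origin under an automorphism, in affine coordinates. -/
theorem exists_center {m : ℕ} {M : Matrix (Fin (m + 2 + 1)) (Fin (m + 2 + 1)) ℂ} {r : ℝ}
    (hr : 0 < r) (hc : ∀ x y, lorentz (M.mulVec x) (M.mulVec y) = r * lorentz x y) :
    ∃ (a : ℂ) (w : Fin (m + 2) → ℂ), a ≠ 0 ∧ M.mulVec (origin _) = a • Fin.cons 1 w ∧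
      a * conj a * (1 - herm w w) = r ∧ ∑ i, ‖w i‖ ^ 2 < 1 := by
  set A := M.mulVec (origin (m + 2)) with hA
  have h := hc (origin _) (origin _)
  rw [lorentz_origin_right, origin_zero, mul_one, ← hA] at h
  -- The image of the origin has positive form value r, so it cannot lie in the negative hyperplane.
  have ha : A 0 ≠ 0 := by
    intro h0
    rw [lorentz_self, Complex.ofReal_inj, h0, norm_zero] at h
    have : 0 ≤ ∑ i : Fin (m + 2), ‖A i.succ‖ ^ 2 := Finset.sum_nonneg fun i _ => by positivity
    nlinarith
  have hAw : A = A 0 • Fin.cons 1 (fun i => A i.succ / A 0) := by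
    funext i
    refine Fin.cases ?_ (fun j => ?_) i
    · simp
    · simp [mul_div_cancel₀ _ ha]
  have hr' : A 0 * conj (A 0) * (1 - herm (fun i => A i.succ / A 0) fun i => A i.succ / A 0) =
      r := by
    rw [← h, ← lorentz_cons, mul_assoc, ← lorentz_smul_right, ← lorentz_smul_left, ← hAw]
  refine ⟨A 0, fun i => A i.succ / A 0, ha, hAw, hr', ?_⟩
  rw [herm_self, Complex.mul_conj'] at hr'
  have h2 : ‖A 0‖ ^ 2 * (1 - ∑ i : Fin (m + 2), ‖A i.succ / A 0‖ ^ 2) = r := by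
    exact_mod_cast hr'
  have h3 : 0 < ‖A 0‖ ^ 2 := by positivity
  by_contra! h4
  nlinarith

theorem mulVec_inv_mulVec {m : ℕ} {M : Matrix (Fin m) (Fin m) ℂ} (hM : IsUnit M.det)
    (x : Fin m → ℂ) : M.mulVec (M⁻¹.mulVec x) = x := by
  rw [Matrix.mulVec_mulVec, Matrix.mul_nonsing_inv M hM, Matrix.one_mulVec]

/-- The polarized form of a member of the family is not the cube of an affine function. -/
theorem not_forall_eq_cube {m : ℕ} {s β C : ℂ} (hs : s ≠ 0) (w : Fin (m + 2) → ℂ)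
    (h : ∀ z : Fin (m + 2) → ℂ, (1 - herm z w) * (1 + s * (z 0 * z 1) + s * conj (w 0 * w 1) +
        β * (herm z w + herm z w ^ 2)) = C * (1 - herm z w) ^ 3) : False := by
  -- Both sides are cubic in z, so the even part at z minus the value at 0 isolates the quadratic
  -- terms; the β contributions cancel there.
  have h2 : ∀ z : Fin (m + 2) → ℂ, s * (z 0 * z 1) = 3 * C * herm z w ^ 2 := fun z => by
    have e0 := h ((0 : ℂ) • z)
    have e1 := h ((1 : ℂ) • z)
    have e2 := h ((-1 : ℂ) • z)
    simp only [herm_smul_left, Pi.smul_apply, smul_eq_mul] at e0 e1 e2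
    linear_combination (e1 + e2) / 2 - e0
  have hw : ∀ i, herm (Pi.single i 1) w = conj (w i) := fun i => by
    simp [herm, Pi.single_apply]
  have hadd : herm (Pi.single 0 1 + Pi.single 1 1) w = conj (w 0) + conj (w 1) := by
    rw [← hw, ← hw]; simp [herm, add_mul, Finset.sum_add_distrib]
  have h01 : (1 : Fin (m + 2)) ≠ 0 := one_ne_zero
  -- z₀z₁ vanishes at both basis vectors but not at their sum, which no multiple of the square of a
  -- linear form can do.
  have e0 := h2 (Pi.single 0 1)
  have e1 := h2 (Pi.single 1 1)
  have e2 := h2 (Pi.single 0 1 + Pi.single 1 1)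
  rw [hw] at e0 e1
  rw [hadd] at e2
  simp [h01, h01.symm] at e0 e1 e2
  rcases e0 with hC | hw0
  · simp [hC, hs] at e2
  · rcases e1 with hC | hw1
    · simp [hC, hs] at e2
    · simp [hw0, hw1, hs] at e2

theorem homogenize_one (n d : ℕ) :
    homogenize d (1 : MvPolynomial (Fin n) ℂ) = X 0 ^ d := by
  rw [homogenize, Finset.sum_eq_single 0]
  · rw [homogeneousComponent_eq_self (isHomogeneous_one _ _), map_one, mul_one, Nat.sub_zero]
  · intro k _ hk
    rw [homogeneousComponent_of_mem (isHomogeneous_one _ _), if_neg hk]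
    simp
  · simp

/-- No member of the family is equivalent to a polynomial map that fixes the origin. -/
theorem RepresentsCRMap.notEquiv {m : ℕ} {t : ℝ × ℝ} (ht : t ∈ region)
    {f : USphere (m + 2) → USphere (Fintype.card (Comp m))}
    (hf : RepresentsCRMap 3 (num m t) (den m t) f) : NotEquivToPolynomialFixingOrigin f := by
  rintro N g ⟨P, hP, hP0⟩ ⟨χ, τ, hχ, hτ, hfg⟩
  set K := max (Fintype.card (Comp m)) N
  set e := Finset.univ.sup fun i => (P i).totalDegree
  have hPe : ∀ i, (P i).totalDegree ≤ e := fun i =>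
    Finset.le_sup (f := fun i => (P i).totalDegree) (Finset.mem_univ i)
  have hK : Fintype.card (Comp m) ≤ K := le_max_left _ _
  have hΨ : IsLift e (padMap (le_max_right _ _ : N ≤ K) g) (liftTuple K e P 1) :=
    isLift_padMap _ hPe (by simp) (by simp [evalAt]) (fun z i => by simp [hP z i, evalAt])
  have hΨo : evalTuple (liftTuple K e P 1) (origin (m + 2)) = origin K := by
    refine funext (Fin.cases ?_ fun i => ?_)
    · simp [evalTuple, liftTuple, homogenize_one]
    · simp only [evalTuple, liftTuple, Fin.cons_succ, zeroExtend, origin]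
      split
      · rw [eval_homogenize (hPe _), hP0]; rfl
      · simp
  obtain ⟨M, c, hM, hc, hχ', hform⟩ := hχ.exists_form
  obtain ⟨r, hr, rfl⟩ := exists_pos_multiplier hM hform
  obtain ⟨a, w, ha, hA, -, -⟩ := exists_center hr hform
  obtain ⟨k, hk⟩ := lorentz_lift_of_polynomial (hf.isLift_famLift hK) hΨ (isRelPrime_famLift ht hK)
    (homogenize_one _ _) hΨo hM hχ' hτ hfg
  have hs : (quadCoeff t : ℂ) ≠ 0 := by exact_mod_cast (quadCoeff_pos ht).ne'
  refine not_forall_eq_cube (C := k * ((r : ℂ)⁻¹) ^ 3) (β := (cubeCoeff t : ℂ) ^ 2) hs w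
    fun z => ?_
  set x := M⁻¹.mulVec (Fin.cons 1 z)
  have hx : M.mulVec x = Fin.cons 1 z := mulVec_inv_mulVec hM _
  -- Pairing with the image of the origin turns x₀ into a multiple of 1 − ⟨z,w⟩, so k·x₀³ becomes a
  -- cube of the required kind.
  have hx0 : conj a * (1 - herm z w) = r * x 0 := by
    rw [← lorentz_cons, ← lorentz_smul_right, ← hA, ← hx, hform, lorentz_origin_right]
  have h := hk x
  rw [hx, hA, evalTuple_smul (homogeneous_famLift m t K), lorentz_smul_right,
    lorentz_famLift ht hK] at h
  have hx0' : x 0 = (r : ℂ)⁻¹ * (conj a * (1 - herm z w)) := by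
    rw [hx0, inv_mul_cancel_left₀ hc]
  rw [hx0', map_pow] at h
  have ha' : conj a ^ 3 ≠ 0 := pow_ne_zero _ (by simpa using ha)
  refine mul_left_cancel₀ ha' (h.trans ?_)
  ring

/-- The center of symmetry of a member of the family is the origin. -/
theorem center_eq_zero {s β ρ : ℝ} {p K₁ K₂ : ℂ} (hs0 : 0 < s) (hs : s < 1) (hβ : 0 < β)
    (hρ0 : 0 ≤ ρ) (hρ : ρ < 1) (hp : 2 * ‖p‖ ≤ ρ)
    (h : ∀ l : ℝ, |l| ≤ 1 → 1 + s * (l ^ 2 * p) + s * conj p + β * (l * ρ + (l * ρ) ^ 2) =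
      K₁ * (1 - l * ρ) ^ 2 + K₂ * (1 - l) ^ 2) : ρ = 0 := by
  have e0 := h 0 (by simp)
  have e1 := h 1 (by simp)
  have e2 := h (-1) (by simp)
  push_cast at e0 e1 e2
  -- For F the quadratic in l, the right side gives (1 − ρ)F′(1) + 2ρF(1) = 0, free of K₁ and K₂;
  -- F′(1) = (3F(1) + F(−1))/2 − 2F(0).
  have key : (1 - ρ) * (2 * s * p + β * ρ + 2 * β * ρ ^ 2) +
      2 * ρ * (1 + s * p + s * conj p + β * ρ + β * ρ ^ 2) = 0 := by
    linear_combination (1 - ρ : ℂ) * ((3 * e1 + e2) / 2 - 2 * e0) + 2 * ρ * e1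
  have hpr : |p.re| ≤ ‖p‖ := Complex.abs_re_le_norm p
  have hre : (1 - ρ) * (2 * s * p.re + β * ρ + 2 * β * ρ ^ 2) +
      2 * ρ * (1 + 2 * s * p.re + β * ρ + β * ρ ^ 2) = 0 := by
    have hp2 : p + conj p = (2 * p.re : ℝ) := by rw [Complex.add_conj]
    have hk := congrArg conj key
    simp only [map_add, map_mul, map_sub, map_pow, map_one, Complex.conj_ofReal, map_zero,
      map_ofNat, Complex.conj_conj] at hk
    have : (1 - ρ : ℂ) * (2 * s * p.re + β * ρ + 2 * β * ρ ^ 2) +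
      2 * ρ * (1 + 2 * s * p.re + β * ρ + β * ρ ^ 2) = 0 := by
      push_cast at hp2
      linear_combination (key + hk) / 2 - ((1 - ρ : ℂ) * s + 2 * ρ * s) * hp2
    exact_mod_cast this
  by_contra hne
  have hρ' : 0 < ρ := lt_of_le_of_ne hρ0 (Ne.symm hne)
  -- The real part of `key` is 2s(1 + ρ)·Re p + 2ρ + βρ(1 + 3ρ), which is at least ρ(2 − s − sρ) +
  -- βρ(1 + 3ρ) > 0 if ρ > 0.
  have h1 : -ρ ≤ 2 * p.re := by linarith [(abs_le.mp hpr).1]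
  have h2 : 0 ≤ s * (2 * p.re + ρ) := mul_nonneg hs0.le (by linarith)
  have h3 : 0 < β * ρ * (1 + 3 * ρ) := by positivity
  have h4 : 0 < ρ * (2 - s - s * ρ) := mul_pos hρ' (by nlinarith)
  nlinarith [mul_nonneg h2 (by linarith : 0 ≤ 1 + ρ)]

theorem two_mul_norm_mul_le {m : ℕ} (z : Fin (m + 2) → ℂ) :
    2 * ‖z 0 * z 1‖ ≤ ∑ i, ‖z i‖ ^ 2 := by
  rw [Fin.sum_univ_succ, Fin.sum_univ_succ, norm_mul]
  have : 0 ≤ ∑ i : Fin m, ‖z i.succ.succ‖ ^ 2 := Finset.sum_nonneg fun i _ => by positivity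
  have h1 : z (Fin.succ 0) = z 1 := rfl
  rw [h1]
  nlinarith [sq_nonneg (‖z 0‖ - ‖z 1‖)]

/-- By the arithmetic-geometric mean inequality, 2|v₀v₁| ≤ |v|², with equality at z = (1, 1, 0, …).
Used in both directions, this shows that s is a unitary invariant. -/
theorem le_quadCoeff_of_eq {m : ℕ} {s t : ℝ × ℝ} (hs : s ∈ region) (ht : t ∈ region)
    {z v : Fin (m + 2) → ℂ} (hz : z = Pi.single 0 1 + Pi.single 1 1)
    (hzv : herm v v = herm z z) (h : (quadCoeff s : ℂ) * (v 0 * v 1) = quadCoeff t * (z 0 * z 1)) :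
    quadCoeff t ≤ quadCoeff s := by
  have hzz : herm z z = 2 := by
    rw [hz]
    simp [herm, mul_add, Finset.sum_add_distrib, Pi.single_apply]
    norm_num
  have hz01 : z 0 * z 1 = 1 := by rw [hz]; simp
  have h1 := two_mul_norm_mul_le v
  have h2 : ∑ i, ‖v i‖ ^ 2 = 2 := by
    rw [hzz, herm_self] at hzv; exact_mod_cast hzv
  have h3 := congrArg norm h
  rw [hz01, mul_one, norm_mul, Complex.norm_real, Complex.norm_real,
    Real.norm_of_nonneg (quadCoeff_pos hs).le, Real.norm_of_nonneg (quadCoeff_pos ht).le] at h3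
  rw [← h3]
  exact mul_le_of_le_one_right (quadCoeff_pos hs).le (by linarith)

/-- If the polarized forms of two members of the family correspond under an automorphism, then
the automorphism fixes the origin. -/
theorem mulVec_origin_of_lorentz_eq {m K : ℕ} {s t : ℝ × ℝ} (hs : s ∈ region) (ht : t ∈ region)
    (hK : Fintype.card (Comp m) ≤ K) {M : Matrix (Fin (m + 2 + 1)) (Fin (m + 2 + 1)) ℂ} {r : ℝ}
    (hM : IsUnit M.det) (hr : 0 < r)
    (hform : ∀ x y, lorentz (M.mulVec x) (M.mulVec y) = r * lorentz x y) {k : ℂ}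
    (hk : ∀ x y, lorentz (evalTuple (famLift m s K) (M.mulVec x))
      (evalTuple (famLift m s K) (M.mulVec y)) =
      k * lorentz (evalTuple (famLift m t K) x) (evalTuple (famLift m t K) y)) :
    ∃ a : ℂ, a * conj a = r ∧ M.mulVec (origin (m + 2)) = a • origin (m + 2) := by
  obtain ⟨a, w, ha, hA, har, hw⟩ := exists_center hr hform
  suffices hρ : ∑ i, ‖w i‖ ^ 2 = 0 by
    rw [herm_self, hρ, Complex.ofReal_zero, sub_zero, mul_one] at har
    rw [Finset.sum_eq_zero_iff_of_nonneg (fun i _ => by positivity)] at hρ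
    have hw0 : w = 0 := funext fun i => by simpa using hρ i (Finset.mem_univ i)
    exact ⟨a, har, by rw [hA, hw0]; rfl⟩
  have hww := herm_self w
  set ρ := ∑ i, ‖w i‖ ^ 2
  have hr0 : (r : ℂ) ≠ 0 := by exact_mod_cast hr.ne'
  have hca : conj a ≠ 0 := by simpa using ha
  set E := M⁻¹.mulVec (origin (m + 2)) with hE
  set u := (r : ℂ)⁻¹ * conj a with hu
  refine center_eq_zero (p := w 0 * w 1) (K₁ := k * (conj a)⁻¹ ^ 3 * u ^ 3)
    (K₂ := k * (conj a)⁻¹ ^ 3 * quadCoeff t * u * (E (Fin.succ 0) * E (Fin.succ 1)))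
    (quadCoeff_pos hs) (quadCoeff_lt_one hs) (pow_pos (cubeCoeff_pos hs) 2)
    (Finset.sum_nonneg fun i _ => by positivity) hw (two_mul_norm_mul_le w) fun l hl => ?_
  -- `x` is chosen so that Mx = (1, l·w) runs through the line joining the origin to the center w.
  -- Its coordinates are affine in l, and all but the zeroth vanish at l = 1.
  set x := (l * a⁻¹ : ℂ) • origin (m + 2) + (1 - l : ℂ) • E with hx
  have hMx : M.mulVec x = Fin.cons 1 ((l : ℂ) • w) := by
    rw [hx, Matrix.mulVec_add, Matrix.mulVec_smul, Matrix.mulVec_smul, hE, mulVec_inv_mulVec hM,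
      hA, smul_smul, inv_mul_cancel_right₀ ha]
    refine funext (Fin.cases ?_ fun i => ?_) <;> simp
  have hx0 : x 0 = u * (1 - l * ρ) := by
    have h := hform x (origin (m + 2))
    rw [hMx, hA, lorentz_smul_right, lorentz_cons, lorentz_origin_right, herm_smul_left, hww] at h
    rw [hu, mul_assoc, h, inv_mul_cancel_left₀ hr0]
  have hlρ : (1 - l * ρ : ℂ) ≠ 0 := by
    have h0 : 0 ≤ ρ := Finset.sum_nonneg fun i _ => by positivity
    have h1 : l ≤ 1 := (abs_le.mp hl).2
    have : 1 - l * ρ ≠ 0 := by nlinarith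
    exact_mod_cast this
  have hu0 : u ≠ 0 := mul_ne_zero (inv_ne_zero hr0) hca
  have hx00 : x 0 ≠ 0 := hx0 ▸ mul_ne_zero hu0 hlρ
  have hxj : ∀ j : Fin (m + 2), x j.succ = (1 - l) * E j.succ := fun j => by simp [hx]
  have hxc : x = x 0 • Fin.cons 1 (fun j => x j.succ / x 0) := by
    refine funext (Fin.cases ?_ fun j => ?_)
    · simp
    · simp [mul_div_cancel₀ _ hx00]
  have h := hk x (origin (m + 2))
  rw [hMx, hA, evalTuple_smul (homogeneous_famLift m s K), lorentz_smul_right,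
    lorentz_famLift hs hK, herm_smul_left, hww, hxc, evalTuple_smul (homogeneous_famLift m t K),
    lorentz_smul_left, origin, lorentz_famLift ht hK] at h
  have hz : ∀ z : Fin (m + 2) → ℂ, herm z 0 = 0 := fun z => by simp [herm]
  have h01 : x 0 ^ 3 * (1 + quadCoeff t * (x (Fin.succ 0) / x 0 * (x (Fin.succ 1) / x 0))) =
      x 0 ^ 3 + quadCoeff t * x 0 * (x (Fin.succ 0) * x (Fin.succ 1)) := by
    field_simp
  simp only [hz, Pi.smul_apply, smul_eq_mul, Pi.zero_apply, mul_zero, map_zero, sub_zero, add_zero,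
    one_mul, zero_pow two_ne_zero, map_pow] at h
  rw [h01, hx0, hxj, hxj] at h
  push_cast
  refine mul_left_cancel₀ (mul_ne_zero (pow_ne_zero 3 hca) hlρ) ?_
  have h3 : conj a ^ 3 * (conj a)⁻¹ ^ 3 = 1 := by rw [← mul_pow, mul_inv_cancel₀ hca, one_pow]
  linear_combination h - (1 - l * ρ : ℂ) * k * (u ^ 3 * (1 - l * ρ : ℂ) ^ 2 +
    quadCoeff t * u * (E (Fin.succ 0) * E (Fin.succ 1)) * (1 - l : ℂ) ^ 2) * h3

/-- Equivalent members of the family have the same parameter. -/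
theorem RepresentsCRMap.eq_of_equiv {m : ℕ} {s t : ℝ × ℝ} (hs : s ∈ region) (ht : t ∈ region)
    {f g : USphere (m + 2) → USphere (Fintype.card (Comp m))}
    (hf : RepresentsCRMap 3 (num m s) (den m s) f) (hg : RepresentsCRMap 3 (num m t) (den m t) g)
    (h : SphericallyEquivalent f g) : s = t := by
  obtain ⟨χ, τ, hχ, hτ, hfg⟩ := h
  set K := max (Fintype.card (Comp m)) (Fintype.card (Comp m))
  have hK : Fintype.card (Comp m) ≤ K := le_max_left _ _
  obtain ⟨M, c, hM, hc, hχ', hform⟩ := hχ.exists_form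
  obtain ⟨r, hr, rfl⟩ := exists_pos_multiplier hM hform
  have hden : famLift m t K 0 ≠ 0 := fun h0 => by
    have := congrArg (eval (Fin.cons 1 0)) h0
    rw [famLift, liftTuple, Fin.cons_zero, eval_homogenize (totalDegree_den_le m t)] at this
    simp [den] at this
  obtain ⟨k, hk⟩ := lorentz_lift_of_same_degree (hf.isLift_famLift hK) (hg.isLift_famLift hK)
    (isRelPrime_famLift hs hK) hden hM hχ' hτ hfg
  obtain ⟨a, har, hA⟩ := mulVec_origin_of_lorentz_eq hs ht hK hM hr hform hk
  have hr0 : (r : ℂ) ≠ 0 := by exact_mod_cast hr.ne'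
  have ha : a ≠ 0 := by rintro rfl; exact hr0 (by rw [← har, zero_mul])
  have hca : conj a ≠ 0 := by simpa using ha
  -- Fixing the origin, `M` also preserves its orthogonal complement, so it acts on affine points by
  -- a unitary map.
  have hM0 : ∀ x, M.mulVec x 0 = a * x 0 := fun x => by
    have h := hform x (origin _)
    rw [hA, lorentz_smul_right, lorentz_origin_right, lorentz_origin_right, ← har] at h
    exact mul_left_cancel₀ hca (h.trans (by ring))
  have hfwd : ∀ z : Fin (m + 2) → ℂ, ∃ v : Fin (m + 2) → ℂ,
      M.mulVec (Fin.cons 1 z) = a • Fin.cons 1 v := fun z => by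
    refine ⟨fun i => M.mulVec (Fin.cons 1 z) i.succ / a, funext (Fin.cases ?_ fun i => ?_)⟩
    · rw [hM0]; simp
    · simp [mul_div_cancel₀ _ ha]
  have hbwd : ∀ v : Fin (m + 2) → ℂ, ∃ z : Fin (m + 2) → ℂ,
      M.mulVec (Fin.cons 1 z) = a • Fin.cons 1 v := fun v => by
    set x := M⁻¹.mulVec (a • Fin.cons 1 v) with hx
    have hMx : M.mulVec x = a • Fin.cons 1 v := mulVec_inv_mulVec hM _
    have hx0 : x 0 = 1 := mul_left_cancel₀ ha (by rw [← hM0, hMx]; simp)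
    refine ⟨fun i => x i.succ, ?_⟩
    rw [← hMx]; congr 1
    exact funext (Fin.cases (by simp [hx0]) fun i => by simp)
  have hherm : ∀ {z v : Fin (m + 2) → ℂ}, M.mulVec (Fin.cons 1 z) = a • Fin.cons 1 v →
      herm v v = herm z z := fun {z v} hzv => by
    have h := hform (Fin.cons 1 z) (Fin.cons 1 z)
    rw [hzv, lorentz_smul_left, lorentz_smul_right, lorentz_cons, lorentz_cons, ← har,
      ← mul_assoc] at h
    have := mul_left_cancel₀ (har ▸ hr0) h
    linear_combination -this
  have hrel : ∀ {z v z' v' : Fin (m + 2) → ℂ}, M.mulVec (Fin.cons 1 z) = a • Fin.cons 1 v →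
      M.mulVec (Fin.cons 1 z') = a • Fin.cons 1 v' →
      (r : ℂ) ^ 3 * ((1 - herm v v') * (1 + quadCoeff s * (v 0 * v 1) +
        quadCoeff s * conj (v' 0 * v' 1) + cubeCoeff s ^ 2 * (herm v v' + herm v v' ^ 2))) =
      k * ((1 - herm z z') * (1 + quadCoeff t * (z 0 * z 1) +
        quadCoeff t * conj (z' 0 * z' 1) + cubeCoeff t ^ 2 * (herm z z' + herm z z' ^ 2))) :=
    fun {z v z' v'} h1 h2 => by
      rw [← lorentz_famLift hs hK, ← lorentz_famLift ht hK, ← hk, h1, h2,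
        evalTuple_smul (homogeneous_famLift m s K), evalTuple_smul (homogeneous_famLift m s K),
        lorentz_smul_left, lorentz_smul_right, ← har, map_pow]
      ring
  have h00 : M.mulVec (Fin.cons 1 0) = a • Fin.cons 1 0 := hA
  have hz : ∀ z : Fin (m + 2) → ℂ, herm z 0 = 0 := fun z => by simp [herm]
  -- Both forms equal 1 at the pair (0, 0), which fixes the constant.
  have hkr : (r : ℂ) ^ 3 = k := by simpa [hz] using hrel h00 h00
  have hk0 : k ≠ 0 := hkr ▸ pow_ne_zero 3 hr0
  have hquad : ∀ {z v : Fin (m + 2) → ℂ}, M.mulVec (Fin.cons 1 z) = a • Fin.cons 1 v →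
      (quadCoeff s : ℂ) * (v 0 * v 1) = quadCoeff t * (z 0 * z 1) := fun hzv => by
    have h := hrel hzv h00
    rw [hkr] at h
    have h' := mul_left_cancel₀ hk0 h
    simpa [hz] using h'
  refine eq_of_coeff_eq hs ht (le_antisymm ?_ ?_) ?_
  · obtain ⟨z, hzv⟩ := hbwd (Pi.single 0 1 + Pi.single 1 1)
    exact le_quadCoeff_of_eq ht hs rfl (hherm hzv).symm (hquad hzv).symm
  · obtain ⟨v, hzv⟩ := hfwd (Pi.single 0 1 + Pi.single 1 1)
    exact le_quadCoeff_of_eq hs ht rfl (hherm hzv) (hquad hzv)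
  -- On the diagonal at squared norm x = 1/4 the coefficient of β is (1 − x)(x + x²) = 15/64, which
  -- is nonzero.
  · obtain ⟨v, hzv⟩ := hfwd (Pi.single 0 (1 / 2))
    have h := hrel hzv hzv
    have hq := hquad hzv
    have h1 : herm (Pi.single 0 (1 / 2)) (Pi.single (0 : Fin (m + 2)) (1 / 2 : ℂ)) = 1 / 4 := by
      have h2 : conj (2 : ℂ) = 2 := map_ofNat _ 2
      simp [herm, Pi.single_apply, h2]; norm_num
    rw [hkr] at h
    have h' := mul_left_cancel₀ hk0 h
    have hq' := congrArg conj hq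
    simp only [map_mul (starRingEnd ℂ) (quadCoeff _ : ℂ), Complex.conj_ofReal] at hq'
    rw [hherm hzv, hq, hq', h1] at h'
    have h2 : (cubeCoeff s : ℂ) ^ 2 = cubeCoeff t ^ 2 := by linear_combination (64 / 15) * h'
    exact_mod_cast h2

end SphereMaps

theorem proposition4p5 :
    (∀ n : ℕ, 2 ≤ n →
      ∃ (N : ℕ) (f : SphereMaps.USphere n → SphereMaps.USphere N),
        SphereMaps.IsRationalCRMap 3 f ∧ SphereMaps.NotEquivToPolynomialFixingOrigin f) ∧
    (∃ (N : ℕ) (U : Set (ℝ × ℝ))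
        (p : ℝ × ℝ → Fin N → MvPolynomial (Fin 2) ℂ) (q : ℝ × ℝ → MvPolynomial (Fin 2) ℂ)
        (F : ℝ × ℝ → SphereMaps.USphere 2 → SphereMaps.USphere N),
      IsOpen U ∧ U.Nonempty ∧
      (∀ i m, ContDiffOn ℝ ∞ (fun t => (p t i).coeff m) U) ∧
      (∀ m, ContDiffOn ℝ ∞ (fun t => (q t).coeff m) U) ∧
      (∀ t ∈ U, SphereMaps.RepresentsCRMap 3 (p t) (q t) (F t) ∧
        SphereMaps.NotEquivToPolynomialFixingOrigin (F t)) ∧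
      (∀ s ∈ U, ∀ t ∈ U, s ≠ t → ¬ SphereMaps.SphericallyEquivalent (F s) (F t))) := by
  have hne : ((1 / 2, 1 / 2) : ℝ × ℝ) ∈ SphereMaps.region := by
    norm_num [SphereMaps.region]
  refine ⟨fun n hn => ?_, ?_⟩
  · obtain ⟨m, rfl⟩ := Nat.exists_eq_add_of_le' hn
    obtain ⟨f, hf⟩ := SphereMaps.exists_representsCRMap hne m
    exact ⟨_, f, ⟨_, _, hf⟩, hf.notEquiv hne⟩
  · obtain ⟨f₀, -⟩ := SphereMaps.exists_representsCRMap hne 0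
    -- `choose!` needs some map as the value of `F` outside `region`; which one does not matter.
    have : Nonempty (SphereMaps.USphere (0 + 2) →
      SphereMaps.USphere (Fintype.card (SphereMaps.Comp 0))) := ⟨f₀⟩
    choose! F hF using fun t (ht : t ∈ SphereMaps.region) =>
      SphereMaps.exists_representsCRMap ht 0
    exact ⟨_, SphereMaps.region, SphereMaps.num 0, SphereMaps.den 0, F,
      SphereMaps.isOpen_region, ⟨_, hne⟩, SphereMaps.contDiffOn_coeff_num 0,
      SphereMaps.contDiffOn_coeff_den 0, fun t ht => ⟨hF t ht, (hF t ht).notEquiv ht⟩,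
      fun s hs t ht hst h => hst ((hF s hs).eq_of_equiv hs ht (hF t ht) h)⟩
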